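/- There are absolute constants $C_1,C_2,C_3,C_4>0$ with the following property. **Setting.** Let $Q\subset\mathbb C^n$ be bounded and let $\mathcal F=\{(\mathcal E_r,\mathcal D_r)\}_{r\in\mathbb N}$ be a family of compression codes, $\mathcal E_r:\mathbb C^n\to\{0,1\}^r$, $\mathcal D_r:\{0,1\}^r\to\mathbb C^n$, with codebooks $\mathcal C_r=\{\mathcal D_r(\mathcal E_r(q)):q\in Q\}$, distortions $\delta_r=\sup_{q\in Q}\|q-\mathcal D_r(\mathcal E_r(q))\|$, rate-distortion function $r(\delta)=\inf\{s:\delta_s<\delta\}$ and $\alpha$-dimension $\dim_\alpha(\mathcal F)=\limsup_{\delta\to0^+} r(\delta)/\log_2\frac1\delta\in[0,\infty]$. For $x\in\mathbb C^n$ and $A\in\mathbb C^{m\times n}$ with rows $a_1^*,\dots,a_m^*$ put $d_A(z)=\sum_{k=1}^m(|a_k^*z|^2-|a_k^*x|^2)^2$, and let $\nabla d_A=(\partial d_A/\partial z)^*$ be its Wirtinger gradient, so that $\nabla d_A(z)=2\sum_k(|a_k^*z|^2-|a_k^*x|^2)a_ka_k^*z$. The GD-COPER iterates at rate $r$ started from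 $z_0\in\mathcal C_r$ are $z_{t+1}\in\arg\min_{c\in\mathcal C_r}\|c-(z_t-\frac1{8m}\nabla d_A(z_t))\|^2$, $t=0,1,2,\dots$, ties being broken arbitrarily. **Claim.** For every $Q$ and $\mathcal F$ as above there is $r_0$ such that the following holds for all $r\ge r_0$ for which $\|c\|=1$ for all $c\in\mathcal C_r$. Let $x\in\mathbb C^n$ with $\|x\|=1$ and $e^{i\theta}x\in Q$ for all $\theta\in\mathbb R$. Let $\delta$ be such that $\delta_r\le\delta$ and $r\le r(\delta)$, i.e. the rate-$r$ code has distortion at most $\delta$ and every code of $\mathcal F$ of smaller rate has distortion at least $\delta$ (for instance $r=r(\delta)$; or $\delta=\delta_r$ if $s\mapsto\delta_s$ is nonincreasing). Let $\tau>0$ with $\delta\le\frac{\tau(1-2\tau)}3$, and let $$m\ge\max\Big\{\Big(\frac{C_2}\tau\Big)^3,\ \frac{C_4}\tau\Big(\dim_\alpha(\mathcal F)\log_2\frac1\delta\Big)^2\Big\}.$$ Let the entries of the random matrix $A\in\mathbb C^{m\times n}$ be i.i.d. with law $\mathcal N(0,1)+i\,\mathcal N(0,1)$ (independent real and imaginary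 parts). Then with probability at least $1-C_3e^{-\frac{C_1\sqrt\tau}2\sqrt m}$, for every initialization $z_0\in\mathcal C_r$ with $\inf_\theta\|e^{i\theta}x-z_0\|=1-2\tau$, all GD-COPER iterates satisfy $$\inf_{\theta\in\mathbb R}\|e^{i\theta}x-z_T\|\le(1-2\tau)(1-\tau)^T+\frac3\tau\,\delta_r\qquad\text{for all }T\ge0.$$ -/

import Mathlib

open MeasureTheory ProbabilityTheory Filter Topology
open scoped ENNReal

noncomputable section

/-- A family of compression codes on `ℂⁿ`, indexed by the rate `r`: an encoder
`ℂⁿ → {0,1}^r` and a decoder `{0,1}^r → ℂⁿ` for every `r`. -/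
structure CodeFamily (n : ℕ) where
  enc : (r : ℕ) → EuclideanSpace ℂ (Fin n) → (Fin r → Bool)
  dec : (r : ℕ) → (Fin r → Bool) → EuclideanSpace ℂ (Fin n)

namespace CodeFamily

variable {n : ℕ} (F : CodeFamily n) (Q : Set (EuclideanSpace ℂ (Fin n)))

/-- The distortion `δ_r = sup_{q ∈ Q} ‖q - D_r (E_r q)‖` of the rate-`r` code on `Q`
(a genuine supremum for bounded `Q`, since `D_r` takes finitely many values). -/
def distortion (r : ℕ) : ℝ := ⨆ q : Q, ‖(q : EuclideanSpace ℂ (Fin n)) - F.dec r (F.enc r q)‖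

/-- The codebook `C_r = D_r (E_r Q)`. -/
def codebook (r : ℕ) : Set (EuclideanSpace ℂ (Fin n)) := (fun q => F.dec r (F.enc r q)) '' Q

/-- The rate-distortion function `r(δ) = inf {r : δ_r < δ}`, equal to `∞` if no such `r` exists. -/
def rate (δ : ℝ) : ℕ∞ := ⨅ (r : ℕ) (_ : F.distortion Q r < δ), (r : ℕ∞)

/-- The `α`-dimension `limsup_{δ → 0+} r(δ) / log₂ (1/δ)`, with values in `[0, ∞]`. -/
def alphaDim : ℝ≥0∞ :=
  limsup (fun δ : ℝ => (F.rate Q δ : ℝ≥0∞) / ENNReal.ofReal (Real.logb 2 (1 / δ))) (𝓝[>] 0)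

end CodeFamily

/-- The law of `g + i h` with `g`, `h` independent standard real Gaussian variables. -/
def stdComplexGaussian : Measure ℂ :=
  ((gaussianReal 0 1).prod (gaussianReal 0 1)).map
    (fun p : ℝ × ℝ => (p.1 : ℂ) + (p.2 : ℂ) * Complex.I)

/-- `d_A(z) = ∑ₖ (|aₖ* z|² - |aₖ* x|²)²`, where `aₖ*` is the `k`-th row of `A`. -/
def dA {m n : ℕ} (A : Matrix (Fin m) (Fin n) ℂ) (x z : EuclideanSpace ℂ (Fin n)) : ℝ :=
  ∑ k : Fin m, (‖A.mulVec z.ofLp k‖ ^ 2 - ‖A.mulVec x.ofLp k‖ ^ 2) ^ 2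

/-- The `j`-th Wirtinger derivative `∂f/∂zⱼ = (∂f/∂(Re zⱼ) - i ∂f/∂(Im zⱼ)) / 2` of a
real-valued function `f` on `ℂⁿ`. -/
def wirtingerDeriv {n : ℕ} (f : EuclideanSpace ℂ (Fin n) → ℝ) (z : EuclideanSpace ℂ (Fin n))
    (j : Fin n) : ℂ :=
  ((fderiv ℝ f z (EuclideanSpace.single j (1 : ℂ)) : ℝ) -
    Complex.I * (fderiv ℝ f z (EuclideanSpace.single j Complex.I) : ℝ)) / 2

/-- The Wirtinger gradient `∇f(z) = (∂f/∂z)*`. -/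
def wirtingerGrad {n : ℕ} (f : EuclideanSpace ℂ (Fin n) → ℝ) (z : EuclideanSpace ℂ (Fin n)) :
    EuclideanSpace ℂ (Fin n) :=
  WithLp.toLp 2 (fun j => star (wirtingerDeriv f z j))

/-- `c` is a projection of `s` on `C`, i.e. a minimiser of `‖c - s‖²` over `c ∈ C`. -/
def IsProjOn {n : ℕ} (C : Set (EuclideanSpace ℂ (Fin n))) (s c : EuclideanSpace ℂ (Fin n)) :
    Prop :=
  c ∈ C ∧ ∀ c' ∈ C, ‖c - s‖ ^ 2 ≤ ‖c' - s‖ ^ 2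

/-- `z₀, z₁, …` are iterates of projected gradient descent on the codebook `C` for the target
`x`, the sensing matrix `A` and the step size `μ`; ties in the projection may be broken
in any way. -/
def IsGDCoper {m n : ℕ} (A : Matrix (Fin m) (Fin n) ℂ) (x : EuclideanSpace ℂ (Fin n))
    (C : Set (EuclideanSpace ℂ (Fin n))) (μ : ℝ) (z : ℕ → EuclideanSpace ℂ (Fin n)) : Prop :=
  z 0 ∈ C ∧ ∀ t, IsProjOn C (z t - (μ : ℂ) • wirtingerGrad (dA A x) (z t)) (z (t + 1))

/-- `inf_θ ‖e^{iθ} x - z‖`. -/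
def phaseDist {n : ℕ} (x z : EuclideanSpace ℂ (Fin n)) : ℝ :=
  ⨅ θ : ℝ, ‖Complex.exp ((θ : ℂ) * Complex.I) • x - z‖

end

/-!
At a unit vector `z` the expectation of `∇d_A(z) / (8m)` is `z - ⟨x, z⟩ x`, so a gradient step with
the mean gradient sends `z` to `⟨x, z⟩ x`. If `d` is the distance from `z` to the orbit
`{e^{iθ} x}` and `y` the nearest point of the orbit, this is at distance `1 - |⟨x, z⟩| = d² / 2`
from `y`. Projecting on the codebook costs a factor `2` and a term `3 δ_r`, because `y` itself has a
codeword at distance at most `δ_r`. If the gradient deviates from its mean by at most `τ d / 2` in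
the directions of differences of codewords (`GradientConcentrates`), then the next distance is at
most `d² + τ d + 3 δ_r ≤ (1 - τ) d + 3 δ_r` as long as `d ≤ 1 - 2τ` (`phaseDist_step_le`), and the
claim follows by induction.

The deviation is controlled for every fixed triple of codewords
(`measure_gradient_deviation_le`). The gradient in direction `w` is a sum of independent terms
`(|a z|² - |a x|²) Re (conj (a w) (a z))`, one for each row `a` of `A`. Each is `d ‖w‖` times a
product of four Gaussians, so the square root of its absolute value has exponential moments. Such a
sum has tail `exp (-c √(mτ))` at deviation `τ m` once `m τ³` is large (`measure_sum_ge_le`: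
truncation and a Chernoff bound). The mean comes from `E |a w|⁴ = 8 ‖w‖⁴` by polarisation.

The union bound runs over at most `8^r` triples, so it needs `r ≲ √(mτ)`. For large `r` the
definition of the `α`-dimension gives `r ≤ 2 dim log₂ (1/δ)`
(`CodeFamily.exists_le_two_mul_alphaDim`), which the hypothesis on `m` turns into this bound. The
factor `2` requires `dim ≠ 0`, and that holds because `Q` contains the circle `{e^{iθ} x}`
(`CodeFamily.alphaDim_ne_zero`); the same circle forces `δ_r > 0`.
-/

/-! ### Moments and linear images of the complex Gaussian law -/

lemma integral_exp_sq_div_four_gaussianReal :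
    Integrable (fun x : ℝ => Real.exp (x ^ 2 / 4)) (gaussianReal 0 1) ∧
      ∫ x, Real.exp (x ^ 2 / 4) ∂(gaussianReal 0 1) = Real.sqrt 2 := by
  have key : ∀ x : ℝ, gaussianPDFReal 0 1 x * Real.exp (x ^ 2 / 4) =
      (Real.sqrt (2 * Real.pi))⁻¹ * Real.exp (-(1 / 4) * x ^ 2) := by
    intro x
    simp only [gaussianPDFReal, NNReal.coe_one, mul_one, sub_zero]
    rw [mul_assoc, ← Real.exp_add]
    congr 2
    ring
  constructor
  · rw [gaussianReal_of_var_ne_zero _ one_ne_zero, gaussianPDF_def,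
      integrable_withDensity_iff_integrable_smul' (by fun_prop) (by simp)]
    simp only [ENNReal.toReal_ofReal (gaussianPDFReal_nonneg _ _ _), smul_eq_mul, key]
    exact (integrable_exp_neg_mul_sq (by norm_num)).const_mul _
  · rw [integral_gaussianReal_eq_integral_smul one_ne_zero]
    simp only [smul_eq_mul, key]
    rw [integral_const_mul, integral_gaussian, ← Real.sqrt_inv, ← Real.sqrt_mul (by positivity)]
    congr 1
    field_simp
    norm_num

/-- The fourth derivative at `0` of the moment generating function `exp (t² / 2)`. -/
lemma integral_pow_four_gaussianReal : ∫ x, x ^ 4 ∂(gaussianReal 0 1) = 3 := by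
  have h := iteratedDeriv_mgf_zero (X := id) (μ := gaussianReal 0 1)
    (by simp [integrableExpSet_id_gaussianReal]) 4
  rw [mgf_id_gaussianReal] at h
  simp only [Pi.pow_apply, id_eq] at h
  rw [← h]
  have dmul {p : ℝ → ℝ} {p' t : ℝ} (hp : HasDerivAt p p' t) :
      HasDerivAt (fun t => p t * Real.exp (t ^ 2 / 2))
        ((p' + p t * t) * Real.exp (t ^ 2 / 2)) t := by
    have hq : HasDerivAt (fun t : ℝ => t ^ 2 / 2) t t := by
      have := (hasDerivAt_pow 2 t).div_const 2
      convert! this using 1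
      simp
    convert! hp.mul hq.exp using 1
    ring
  have d1 : deriv (fun t : ℝ => Real.exp (t ^ 2 / 2)) = fun t => t * Real.exp (t ^ 2 / 2) := by
    funext t
    have := (dmul (hasDerivAt_const t (1 : ℝ))).deriv
    simpa using this
  have d2 : deriv (fun t : ℝ => t * Real.exp (t ^ 2 / 2)) =
      fun t => (1 + t ^ 2) * Real.exp (t ^ 2 / 2) := by
    funext t
    rw [(dmul (hasDerivAt_id' t)).deriv]
    ring
  have d3 : deriv (fun t : ℝ => (1 + t ^ 2) * Real.exp (t ^ 2 / 2)) =
      fun t => (3 * t + t ^ 3) * Real.exp (t ^ 2 / 2) := by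
    funext t
    rw [(dmul ((hasDerivAt_pow 2 t).const_add 1)).deriv]
    norm_num
    ring
  have d4 : deriv (fun t : ℝ => (3 * t + t ^ 3) * Real.exp (t ^ 2 / 2)) =
      fun t => (3 + 6 * t ^ 2 + t ^ 4) * Real.exp (t ^ 2 / 2) := by
    funext t
    rw [(dmul (((hasDerivAt_id' t).const_mul 3).fun_add (hasDerivAt_pow 3 t))).deriv]
    norm_num
    ring
  have e : (fun t : ℝ => Real.exp (0 * t + ((1 : NNReal) : ℝ) * t ^ 2 / 2)) =
      fun t => Real.exp (t ^ 2 / 2) := by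
    funext t; simp
  rw [e]
  simp only [iteratedDeriv_succ, iteratedDeriv_zero, d1, d2, d3, d4]
  norm_num

lemma integrable_pow_gaussianReal (k : ℕ) : Integrable (fun x : ℝ => x ^ k) (gaussianReal 0 1) := by
  have := integrable_pow_of_mem_interior_integrableExpSet (X := id) (μ := gaussianReal 0 1)
    (by simp [integrableExpSet_id_gaussianReal]) k
  simpa using this

lemma integral_sq_gaussianReal : ∫ x, x ^ 2 ∂(gaussianReal 0 1) = 1 := by
  have h := variance_fun_id_gaussianReal (μ := 0) (v := 1)
  rw [variance_of_integral_eq_zero (by fun_prop) (by simp)] at h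
  simpa using h

instance : IsProbabilityMeasure stdComplexGaussian := by
  unfold stdComplexGaussian
  exact Measure.isProbabilityMeasure_map (by fun_prop)

lemma integrable_stdComplexGaussian_iff {f : ℂ → ℝ} (hf : Continuous f) :
    Integrable f stdComplexGaussian ↔
      Integrable (fun p : ℝ × ℝ => f ((p.1 : ℂ) + (p.2 : ℂ) * Complex.I))
        ((gaussianReal 0 1).prod (gaussianReal 0 1)) := by
  unfold stdComplexGaussian
  rw [integrable_map_measure hf.aestronglyMeasurable (by fun_prop)]
  rfl

lemma integral_stdComplexGaussian {f : ℂ → ℝ} (hf : Continuous f) :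
    ∫ g, f g ∂stdComplexGaussian =
      ∫ p : ℝ × ℝ, f ((p.1 : ℂ) + (p.2 : ℂ) * Complex.I)
        ∂((gaussianReal 0 1).prod (gaussianReal 0 1)) := by
  unfold stdComplexGaussian
  rw [integral_map (by fun_prop) hf.aestronglyMeasurable]

lemma Complex.sq_norm_ofReal_add_ofReal_mul_I (a b : ℝ) :
    ‖(a : ℂ) + (b : ℂ) * Complex.I‖ ^ 2 = a ^ 2 + b ^ 2 := by
  rw [← Complex.normSq_eq_norm_sq, Complex.normSq_add_mul_I]

lemma integral_exp_sq_norm_stdComplexGaussian :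
    Integrable (fun g : ℂ => Real.exp (‖g‖ ^ 2 / 4)) stdComplexGaussian ∧
      ∫ g, Real.exp (‖g‖ ^ 2 / 4) ∂stdComplexGaussian = 2 := by
  have h := integral_exp_sq_div_four_gaussianReal
  rw [integrable_stdComplexGaussian_iff (by fun_prop), integral_stdComplexGaussian (by fun_prop)]
  simp only [Complex.sq_norm_ofReal_add_ofReal_mul_I, add_div, Real.exp_add]
  refine ⟨h.1.mul_prod h.1, ?_⟩
  rw [integral_prod_mul (fun x : ℝ => Real.exp (x ^ 2 / 4)) (fun x : ℝ => Real.exp (x ^ 2 / 4)),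
    h.2, Real.mul_self_sqrt (by norm_num)]

lemma integral_norm_pow_four_stdComplexGaussian :
    Integrable (fun g : ℂ => ‖g‖ ^ 4) stdComplexGaussian ∧
      ∫ g, ‖g‖ ^ 4 ∂stdComplexGaussian = 8 := by
  rw [integrable_stdComplexGaussian_iff (by fun_prop), integral_stdComplexGaussian (by fun_prop)]
  have e : ∀ p : ℝ × ℝ, ‖(p.1 : ℂ) + (p.2 : ℂ) * Complex.I‖ ^ 4 =
      p.1 ^ 4 + 2 * (p.1 ^ 2 * p.2 ^ 2) + p.2 ^ 4 := by
    intro p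
    rw [show (4 : ℕ) = 2 * 2 from rfl, pow_mul, Complex.sq_norm_ofReal_add_ofReal_mul_I]
    ring
  simp only [e]
  have i1 : Integrable (fun p : ℝ × ℝ => p.1 ^ 4) ((gaussianReal 0 1).prod (gaussianReal 0 1)) :=
    (integrable_pow_gaussianReal 4).comp_fst _
  have i2 : Integrable (fun p : ℝ × ℝ => p.2 ^ 4) ((gaussianReal 0 1).prod (gaussianReal 0 1)) :=
    (integrable_pow_gaussianReal 4).comp_snd _
  have i3 : Integrable (fun p : ℝ × ℝ => 2 * (p.1 ^ 2 * p.2 ^ 2))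
      ((gaussianReal 0 1).prod (gaussianReal 0 1)) :=
    ((integrable_pow_gaussianReal 2).mul_prod (integrable_pow_gaussianReal 2)).const_mul 2
  refine ⟨(i1.add i3).add i2, ?_⟩
  rw [integral_add (by exact i1.add i3) i2, integral_add i1 i3, integral_const_mul,
    integral_prod_mul (fun x : ℝ => x ^ 2) (fun x : ℝ => x ^ 2),
    integral_fun_fst (fun x : ℝ => x ^ 4), integral_fun_snd (fun x : ℝ => x ^ 4)]
  simp [integral_pow_four_gaussianReal, integral_sq_gaussianReal]
  norm_num

lemma charFun_stdComplexGaussian (t : ℂ) :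
    charFun stdComplexGaussian t = Complex.exp (-(‖t‖ ^ 2 / 2 : ℝ)) := by
  rw [charFun_apply]
  unfold stdComplexGaussian
  rw [integral_map (by fun_prop) (by fun_prop)]
  have e : ∀ p : ℝ × ℝ, Complex.exp
      (((inner ℝ ((p.1 : ℂ) + (p.2 : ℂ) * Complex.I) t : ℝ) : ℂ) * Complex.I) =
      Complex.exp (t.re * p.1 * Complex.I) * Complex.exp (t.im * p.2 * Complex.I) := by
    intro p
    rw [← Complex.exp_add, Complex.inner]
    congr 1
    simp [Complex.mul_re]
    ring
  simp only [e]
  rw [integral_prod_mul (fun x : ℝ => Complex.exp (t.re * x * Complex.I))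
    (fun x : ℝ => Complex.exp (t.im * x * Complex.I)), ← charFun_apply_real, ← charFun_apply_real,
    charFun_gaussianReal, charFun_gaussianReal, ← Complex.exp_add, ← Complex.normSq_eq_norm_sq,
    Complex.normSq_apply]
  congr 1
  push_cast
  simp
  ring

/-- The law of a vector of `n` independent standard complex Gaussians, that is, of a row of the
sensing matrix. -/
noncomputable def gaussianRow (n : ℕ) : Measure (Fin n → ℂ) :=
  Measure.pi fun _ => stdComplexGaussian

instance (n : ℕ) : IsProbabilityMeasure (gaussianRow n) := by
  unfold gaussianRow; infer_instance

lemma measurable_dotProduct {n : ℕ} (w : Fin n → ℂ) :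
    Measurable (fun a : Fin n → ℂ => dotProduct a w) := by
  unfold dotProduct
  fun_prop

/-- Unitary invariance of the complex Gaussian law. -/
lemma map_dotProduct_gaussianRow {n : ℕ} (w : EuclideanSpace ℂ (Fin n)) :
    (gaussianRow n).map (fun a => dotProduct a w.ofLp) =
      stdComplexGaussian.map (fun g => (‖w‖ : ℝ) • g) := by
  have hp1 : IsProbabilityMeasure ((gaussianRow n).map (fun a => dotProduct a w.ofLp)) :=
    Measure.isProbabilityMeasure_map (measurable_dotProduct _).aemeasurable
  have hp2 : IsProbabilityMeasure (stdComplexGaussian.map (fun g : ℂ => (‖w‖ : ℝ) • g)) :=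
    Measure.isProbabilityMeasure_map (by fun_prop)
  refine Measure.ext_of_charFun (funext fun t => ?_)
  have hind : iIndepFun (fun (j : Fin n) (a : Fin n → ℂ) => a j * w j) (gaussianRow n) :=
    iIndepFun_pi (μ := fun _ : Fin n => stdComplexGaussian) (X := fun j (z : ℂ) => z * w j)
      (fun j => by fun_prop)
  have h1 := hind.charFun_map_fun_sum_eq_prod
    (fun j => (show Measurable fun a : Fin n → ℂ => a j * w j by fun_prop).aemeasurable)
  have hj (j : Fin n) : charFun ((gaussianRow n).map (fun a => a j * w j)) t =
      Complex.exp (-(‖t‖ ^ 2 * ‖w j‖ ^ 2 / 2 : ℝ)) := by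
    have : (gaussianRow n).map (fun a => a j * w j) = stdComplexGaussian.map (fun g => g * w j) := by
      have hm : (gaussianRow n).map (fun a => a j) = stdComplexGaussian :=
        (measurePreserving_eval (fun _ : Fin n => stdComplexGaussian) j).map_eq
      conv_rhs => rw [← hm]
      rw [Measure.map_map (by fun_prop) (by fun_prop)]
      rfl
    rw [this, charFun_apply, integral_map (by fun_prop) (by fun_prop)]
    have e : ∀ g : ℂ, (inner ℝ (g * w j) t : ℝ) = inner ℝ g (t * star (w j)) := by
      intro g
      simp [Complex.inner, Complex.mul_re, Complex.mul_im]
      ring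
    simp only [e]
    rw [← charFun_apply, charFun_stdComplexGaussian, norm_mul, norm_star, mul_pow]
  change charFun ((gaussianRow n).map (fun a => ∑ j, a j * w j)) t = _
  rw [h1, Finset.prod_apply, charFun_map_smul, charFun_stdComplexGaussian]
  simp only [hj]
  rw [← Complex.exp_sum, norm_smul, mul_pow, norm_norm, EuclideanSpace.norm_sq_eq]
  congr 1
  push_cast
  rw [Finset.sum_neg_distrib, ← Finset.sum_div, ← Finset.mul_sum]
  ring

lemma integral_dotProduct_gaussianRow {n : ℕ} (w : EuclideanSpace ℂ (Fin n)) {f : ℂ → ℝ}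
    (hf : Continuous f) :
    ∫ a, f (dotProduct a w.ofLp) ∂(gaussianRow n) =
      ∫ g, f ((‖w‖ : ℝ) • g) ∂stdComplexGaussian := by
  rw [← integral_map (φ := fun a : Fin n → ℂ => dotProduct a w.ofLp)
      (measurable_dotProduct _).aemeasurable hf.aestronglyMeasurable,
    map_dotProduct_gaussianRow, integral_map (by fun_prop) hf.aestronglyMeasurable]

lemma integrable_dotProduct_gaussianRow {n : ℕ} (w : EuclideanSpace ℂ (Fin n)) {f : ℂ → ℝ}
    (hf : Continuous f) (hi : Integrable (fun g => f ((‖w‖ : ℝ) • g)) stdComplexGaussian) :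
    Integrable (fun a => f (dotProduct a w.ofLp)) (gaussianRow n) := by
  have : Integrable f ((gaussianRow n).map (fun a => dotProduct a w.ofLp)) := by
    rw [map_dotProduct_gaussianRow, integrable_map_measure hf.aestronglyMeasurable (by fun_prop)]
    exact hi
  rwa [integrable_map_measure hf.aestronglyMeasurable (measurable_dotProduct _).aemeasurable] at this

lemma integrable_norm_dotProduct_pow_four {n : ℕ} (w : EuclideanSpace ℂ (Fin n)) :
    Integrable (fun a => ‖dotProduct a w.ofLp‖ ^ 4) (gaussianRow n) := by
  refine integrable_dotProduct_gaussianRow w (f := fun z => ‖z‖ ^ 4) (by fun_prop) ?_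
  simp only [norm_smul, mul_pow]
  exact integral_norm_pow_four_stdComplexGaussian.1.const_mul _

lemma integral_norm_dotProduct_pow_four {n : ℕ} (w : EuclideanSpace ℂ (Fin n)) :
    ∫ a, ‖dotProduct a w.ofLp‖ ^ 4 ∂(gaussianRow n) = 8 * ‖w‖ ^ 4 := by
  rw [integral_dotProduct_gaussianRow w (f := fun z => ‖z‖ ^ 4) (by fun_prop)]
  simp only [norm_smul, mul_pow, norm_norm]
  rw [integral_const_mul, integral_norm_pow_four_stdComplexGaussian.2, mul_comm]

/-- A row paired with a vector of norm at most `2` has a subgaussian modulus. -/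
lemma integral_exp_sq_norm_dotProduct_le {n : ℕ} (w : EuclideanSpace ℂ (Fin n)) (hw : ‖w‖ ≤ 2) :
    Integrable (fun a => Real.exp (‖dotProduct a w.ofLp‖ ^ 2 / 16)) (gaussianRow n) ∧
      ∫ a, Real.exp (‖dotProduct a w.ofLp‖ ^ 2 / 16) ∂(gaussianRow n) ≤ 2 := by
  have hf : Continuous (fun z : ℂ => Real.exp (‖z‖ ^ 2 / 16)) := by fun_prop
  have hle : ∀ g : ℂ, Real.exp (‖(‖w‖ : ℝ) • g‖ ^ 2 / 16) ≤ Real.exp (‖g‖ ^ 2 / 4) := by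
    intro g
    rw [Real.exp_le_exp, norm_smul, norm_norm, mul_pow]
    have : ‖w‖ ^ 2 ≤ 2 ^ 2 := by gcongr
    nlinarith [sq_nonneg ‖g‖]
  have hi : Integrable (fun g : ℂ => Real.exp (‖(‖w‖ : ℝ) • g‖ ^ 2 / 16)) stdComplexGaussian := by
    refine integral_exp_sq_norm_stdComplexGaussian.1.mono' (by fun_prop) (ae_of_all _ fun g => ?_)
    rw [Real.norm_of_nonneg (by positivity)]
    exact hle g
  refine ⟨integrable_dotProduct_gaussianRow w hf hi, ?_⟩
  rw [integral_dotProduct_gaussianRow w hf, ← integral_exp_sq_norm_stdComplexGaussian.2]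
  exact integral_mono hi integral_exp_sq_norm_stdComplexGaussian.1 hle

/-! ### The mean gradient -/

/-- Polarisation: the fourth powers of `‖x + ω w‖` over the fourth roots of unity `ω`. -/
lemma norm_pow_four_polarization {E : Type*} [NormedAddCommGroup E] [InnerProductSpace ℂ E]
    (x w : E) :
    ‖x + w‖ ^ 4 + ‖x - w‖ ^ 4 + ‖x + Complex.I • w‖ ^ 4 + ‖x - Complex.I • w‖ ^ 4 =
      4 * (‖x‖ ^ 2 + ‖w‖ ^ 2) ^ 2 + 8 * ‖inner ℂ x w‖ ^ 2 := by
  have h1 := norm_add_sq (𝕜 := ℂ) x w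
  have h2 := norm_sub_sq (𝕜 := ℂ) x w
  have h3 := norm_add_sq (𝕜 := ℂ) x (Complex.I • w)
  have h4 := norm_sub_sq (𝕜 := ℂ) x (Complex.I • w)
  rw [inner_smul_right, norm_smul, Complex.norm_I, one_mul] at h3 h4
  simp only [RCLike.re_eq_complex_re, Complex.I_mul_re] at h1 h2 h3 h4
  have hn : ‖inner ℂ x w‖ ^ 2 = (inner ℂ x w).re ^ 2 + (inner ℂ x w).im ^ 2 := by
    rw [← Complex.normSq_eq_norm_sq, Complex.normSq_apply]
    ring
  have e (y : E) : ‖y‖ ^ 4 = (‖y‖ ^ 2) ^ 2 := by ring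
  rw [e (x + w), e (x - w), e (x + _), e (x - _), h1, h2, h3, h4, hn]
  ring

lemma dotProduct_add_ofLp {n : ℕ} (a : Fin n → ℂ) (p q : EuclideanSpace ℂ (Fin n)) :
    dotProduct a (p + q).ofLp = dotProduct a p.ofLp + dotProduct a q.ofLp := by
  rw [WithLp.ofLp_add, dotProduct_add]

lemma dotProduct_sub_ofLp {n : ℕ} (a : Fin n → ℂ) (p q : EuclideanSpace ℂ (Fin n)) :
    dotProduct a (p - q).ofLp = dotProduct a p.ofLp - dotProduct a q.ofLp := by
  rw [WithLp.ofLp_sub, dotProduct_sub]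

lemma dotProduct_smul_ofLp {n : ℕ} (a : Fin n → ℂ) (c : ℂ) (p : EuclideanSpace ℂ (Fin n)) :
    dotProduct a (c • p).ofLp = c * dotProduct a p.ofLp := by
  rw [WithLp.ofLp_smul, dotProduct_smul, smul_eq_mul]

/-- Wick's formula for two squared moduli, from fourth powers by polarisation. -/
lemma integral_sq_norm_dotProduct_mul {n : ℕ} (p q : EuclideanSpace ℂ (Fin n)) :
    Integrable (fun a => ‖dotProduct a p.ofLp‖ ^ 2 * ‖dotProduct a q.ofLp‖ ^ 2) (gaussianRow n) ∧
      ∫ a, ‖dotProduct a p.ofLp‖ ^ 2 * ‖dotProduct a q.ofLp‖ ^ 2 ∂(gaussianRow n) =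
        4 * (‖p‖ ^ 2 * ‖q‖ ^ 2 + ‖inner ℂ p q‖ ^ 2) := by
  have e : (fun a => ‖dotProduct a p.ofLp‖ ^ 2 * ‖dotProduct a q.ofLp‖ ^ 2) =
      fun a => (1 / 16 : ℝ) * ((‖dotProduct a (p + q).ofLp‖ ^ 4 +
        ‖dotProduct a (p - q).ofLp‖ ^ 4 + ‖dotProduct a (p + Complex.I • q).ofLp‖ ^ 4 +
        ‖dotProduct a (p - Complex.I • q).ofLp‖ ^ 4) -
        (4 * ‖dotProduct a p.ofLp‖ ^ 4 + 4 * ‖dotProduct a q.ofLp‖ ^ 4)) := by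
    funext a
    have h := norm_pow_four_polarization (dotProduct a p.ofLp) (dotProduct a q.ofLp)
    simp only [dotProduct_add_ofLp, dotProduct_sub_ofLp, dotProduct_smul_ofLp]
    simp only [smul_eq_mul] at h
    rw [h, RCLike.inner_apply, norm_mul, RCLike.norm_conj]
    ring
  have i (w : EuclideanSpace ℂ (Fin n)) := integrable_norm_dotProduct_pow_four w
  have i3 := ((i (p + q)).fun_add (i (p - q)))
  have i4 := i3.fun_add (i (p + Complex.I • q))
  have i5 := i4.fun_add (i (p - Complex.I • q))
  have i6 := ((i p).const_mul 4).fun_add ((i q).const_mul 4)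
  rw [e]
  refine ⟨(i5.sub i6).const_mul _, ?_⟩
  rw [integral_const_mul, integral_sub i5 i6, integral_add i4 (i _), integral_add i3 (i _),
    integral_add (i _) (i _), integral_add ((i p).const_mul 4) ((i q).const_mul 4),
    integral_const_mul, integral_const_mul]
  simp only [integral_norm_dotProduct_pow_four]
  have h := norm_pow_four_polarization p q
  linear_combination (1 / 2 : ℝ) * h

/-- The contribution of the row `a` to `∂d_A(z)/∂w`, up to the factor `4`:
`(|a z|² - |a x|²) Re (conj (a w) (a z))`. -/
noncomputable def rowGrad {n : ℕ} (x z w : EuclideanSpace ℂ (Fin n)) (a : Fin n → ℂ) : ℝ :=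
  (‖dotProduct a z.ofLp‖ ^ 2 - ‖dotProduct a x.ofLp‖ ^ 2) *
    (star (dotProduct a w.ofLp) * dotProduct a z.ofLp).re

lemma measurable_rowGrad {n : ℕ} (x z w : EuclideanSpace ℂ (Fin n)) :
    Measurable (rowGrad x z w) := by
  have h (v : EuclideanSpace ℂ (Fin n)) := measurable_dotProduct v.ofLp
  exact (((h z).norm.pow_const 2).sub ((h x).norm.pow_const 2)).mul
    (Complex.measurable_re.comp ((continuous_star.measurable.comp (h w)).mul (h z)))

/-- The expectation of the gradient: its direction at a unit vector `z` is `z - ⟨x, z⟩ x`. -/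
lemma integral_rowGrad {n : ℕ} (x z w : EuclideanSpace ℂ (Fin n)) (hx : ‖x‖ = 1) (hz : ‖z‖ = 1) :
    Integrable (rowGrad x z w) (gaussianRow n) ∧
      ∫ a, rowGrad x z w a ∂(gaussianRow n) = 4 * (inner ℂ w (z - inner ℂ x z • x)).re := by
  have e : rowGrad x z w = fun a => (1 / 4 : ℝ) *
      ((‖dotProduct a z.ofLp‖ ^ 2 * ‖dotProduct a (z + w).ofLp‖ ^ 2 -
        ‖dotProduct a z.ofLp‖ ^ 2 * ‖dotProduct a (z - w).ofLp‖ ^ 2) -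
      (‖dotProduct a x.ofLp‖ ^ 2 * ‖dotProduct a (z + w).ofLp‖ ^ 2 -
        ‖dotProduct a x.ofLp‖ ^ 2 * ‖dotProduct a (z - w).ofLp‖ ^ 2)) := by
    funext a
    simp only [rowGrad, dotProduct_add_ofLp, dotProduct_sub_ofLp, ← Complex.normSq_eq_norm_sq,
      Complex.normSq_apply, Complex.add_re, Complex.add_im, Complex.sub_re, Complex.sub_im,
      Complex.mul_re, RCLike.star_def, Complex.conj_re, Complex.conj_im]
    ring
  have i (p q : EuclideanSpace ℂ (Fin n)) := (integral_sq_norm_dotProduct_mul p q).1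
  have i1 := (i z (z + w)).sub (i z (z - w))
  have i2 := (i x (z + w)).sub (i x (z - w))
  rw [e]
  refine ⟨(i1.sub i2).const_mul _, ?_⟩
  rw [integral_const_mul, integral_sub (by exact i1) (by exact i2), integral_sub (i _ _) (i _ _),
    integral_sub (i _ _) (i _ _)]
  simp only [(integral_sq_norm_dotProduct_mul _ _).2, inner_add_right, inner_sub_right,
    inner_smul_right, hx, hz]
  have h1 := norm_add_sq (𝕜 := ℂ) z w
  have h2 := norm_sub_sq (𝕜 := ℂ) z w
  have hzz : inner ℂ z z = (1 : ℂ) := by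
    rw [inner_self_eq_norm_sq_to_K, hz]
    simp
  have hwz : (inner ℂ w z).re = (inner ℂ z w).re := by
    rw [← inner_conj_symm w z, Complex.conj_re]
  have hwx : inner ℂ w x = star (inner ℂ x w) := by
    rw [← inner_conj_symm w x]
    rfl
  rw [h1, h2, hzz, hwx, Complex.sub_re, hwz]
  simp only [← Complex.normSq_eq_norm_sq, Complex.normSq_apply, Complex.add_re, Complex.add_im,
    Complex.sub_re, Complex.sub_im, Complex.mul_re, RCLike.star_def,
    Complex.conj_re, Complex.conj_im, Complex.one_re, Complex.one_im, RCLike.re_eq_complex_re]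
  ring

/-! ### Exponential moments of the row terms -/

lemma sqrt_mul_mul_mul_le {a b c d : ℝ} (hc : 0 ≤ c) (hd : 0 ≤ d) :
    Real.sqrt (a * b * (c * d)) ≤ (a ^ 2 + b ^ 2 + c ^ 2 + d ^ 2) / 4 := by
  rw [Real.sqrt_le_left (by positivity)]
  have h1 : a * b ≤ (a ^ 2 + b ^ 2) / 2 := by nlinarith [sq_nonneg (a - b)]
  have h2 : c * d ≤ (c ^ 2 + d ^ 2) / 2 := by nlinarith [sq_nonneg (c - d)]
  have h3 : a * b * (c * d) ≤ (a ^ 2 + b ^ 2) / 2 * ((c ^ 2 + d ^ 2) / 2) := by gcongr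
  nlinarith [sq_nonneg (a ^ 2 + b ^ 2 - (c ^ 2 + d ^ 2))]

lemma exp_sum_four_div_le (a b c d : ℝ) :
    Real.exp ((a + b + c + d) / 4) ≤
      (Real.exp a + Real.exp b + Real.exp c + Real.exp d) / 4 := by
  have h2 (x y : ℝ) : Real.exp ((x + y) / 2) ≤ (Real.exp x + Real.exp y) / 2 := by
    have e1 : Real.exp x = Real.exp (x / 2) ^ 2 := by
      rw [← Real.exp_nat_mul]; congr 1; push_cast; ring
    have e2 : Real.exp y = Real.exp (y / 2) ^ 2 := by
      rw [← Real.exp_nat_mul]; congr 1; push_cast; ring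
    rw [e1, e2, add_div, Real.exp_add]
    nlinarith [sq_nonneg (Real.exp (x / 2) - Real.exp (y / 2))]
  have := h2 ((a + b) / 2) ((c + d) / 2)
  rw [show (a + b + c + d) / 4 = ((a + b) / 2 + (c + d) / 2) / 2 by ring]
  linarith [h2 a b, h2 c d]

/-- A row term is a product of four Gaussians, so its square root has exponential moments. The
factor `|a z|² - |a x|²` is bounded through `|a (z - y)| |a (z + y)|`, for a rotation `y` of `x`;
this is where the distance `‖z - y‖` comes in. -/
lemma integral_exp_sqrt_rowGrad_le {n : ℕ} {x y z w : EuclideanSpace ℂ (Fin n)}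
    (hz : ‖z‖ = 1) (hy : ‖y‖ = 1) (hyx : ∃ c : ℂ, ‖c‖ = 1 ∧ y = c • x) (hzy : z ≠ y) (hw : w ≠ 0)
    {s : ℝ} (hs : |s| = (‖z - y‖ * ‖w‖)⁻¹) :
    Integrable (fun a => Real.exp (Real.sqrt |s * rowGrad x z w a| / 16)) (gaussianRow n) ∧
      ∫ a, Real.exp (Real.sqrt |s * rowGrad x z w a| / 16) ∂(gaussianRow n) ≤ 2 := by
  have hd : 0 < ‖z - y‖ := norm_pos_iff.2 (sub_ne_zero.2 hzy)
  have hw' : 0 < ‖w‖ := norm_pos_iff.2 hw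
  set v₁ := ((‖z - y‖⁻¹ : ℝ) : ℂ) • (z - y) with hv₁
  set v₃ := ((‖w‖⁻¹ : ℝ) : ℂ) • w with hv₃
  have n₁ : ‖v₁‖ ≤ 2 := by
    rw [hv₁, norm_smul, Complex.norm_real, norm_inv, norm_norm, inv_mul_cancel₀ hd.ne']
    norm_num
  have n₂ : ‖z + y‖ ≤ 2 := (norm_add_le _ _).trans (by rw [hz, hy]; norm_num)
  have n₃ : ‖v₃‖ ≤ 2 := by
    rw [hv₃, norm_smul, Complex.norm_real, norm_inv, norm_norm, inv_mul_cancel₀ hw'.ne']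
    norm_num
  have n₄ : ‖z‖ ≤ 2 := by rw [hz]; norm_num
  have k₁ := integral_exp_sq_norm_dotProduct_le v₁ n₁
  have k₂ := integral_exp_sq_norm_dotProduct_le (z + y) n₂
  have k₃ := integral_exp_sq_norm_dotProduct_le v₃ n₃
  have k₄ := integral_exp_sq_norm_dotProduct_le z n₄
  have bound (a : Fin n → ℂ) : |s * rowGrad x z w a| ≤
      ‖dotProduct a v₁.ofLp‖ * ‖dotProduct a (z + y).ofLp‖ *
        (‖dotProduct a v₃.ofLp‖ * ‖dotProduct a z.ofLp‖) := by
    obtain ⟨c, hc, rfl⟩ := hyx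
    have hax : ‖dotProduct a x.ofLp‖ = ‖dotProduct a (c • x).ofLp‖ := by
      rw [dotProduct_smul_ofLp, norm_mul, hc, one_mul]
    have b1 : |‖dotProduct a z.ofLp‖ ^ 2 - ‖dotProduct a x.ofLp‖ ^ 2| ≤
        ‖dotProduct a (z - c • x).ofLp‖ * ‖dotProduct a (z + c • x).ofLp‖ := by
      rw [hax, dotProduct_sub_ofLp, dotProduct_add_ofLp, ← norm_mul]
      set p := dotProduct a z.ofLp
      set q := dotProduct a (c • x).ofLp
      have : ‖p‖ ^ 2 - ‖q‖ ^ 2 = ((p - q) * star (p + q)).re := by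
        simp only [← Complex.normSq_eq_norm_sq, Complex.normSq_apply, Complex.mul_re,
          RCLike.star_def, Complex.conj_re, Complex.conj_im, Complex.sub_re, Complex.sub_im,
          Complex.add_re, Complex.add_im]
        ring
      rw [this]
      refine (Complex.abs_re_le_norm _).trans (le_of_eq ?_)
      rw [norm_mul, norm_star, norm_mul]
    have b2 : |(star (dotProduct a w.ofLp) * dotProduct a z.ofLp).re| ≤
        ‖dotProduct a w.ofLp‖ * ‖dotProduct a z.ofLp‖ := by
      refine (Complex.abs_re_le_norm _).trans (le_of_eq ?_)
      rw [norm_mul, norm_star]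
    have e₁ : ‖dotProduct a v₁.ofLp‖ = ‖z - c • x‖⁻¹ * ‖dotProduct a (z - c • x).ofLp‖ := by
      rw [hv₁, dotProduct_smul_ofLp, norm_mul, Complex.norm_real, norm_inv, norm_norm]
    have e₃ : ‖dotProduct a v₃.ofLp‖ = ‖w‖⁻¹ * ‖dotProduct a w.ofLp‖ := by
      rw [hv₃, dotProduct_smul_ofLp, norm_mul, Complex.norm_real, norm_inv, norm_norm]
    rw [abs_mul, hs, rowGrad, abs_mul, e₁, e₃, mul_inv]
    calc _ ≤ ‖z - c • x‖⁻¹ * ‖w‖⁻¹ *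
          (‖dotProduct a (z - c • x).ofLp‖ * ‖dotProduct a (z + c • x).ofLp‖ *
            (‖dotProduct a w.ofLp‖ * ‖dotProduct a z.ofLp‖)) := by gcongr
      _ = _ := by ring
  have pw (a : Fin n → ℂ) : Real.exp (Real.sqrt |s * rowGrad x z w a| / 16) ≤
      (Real.exp (‖dotProduct a v₁.ofLp‖ ^ 2 / 16) +
        Real.exp (‖dotProduct a (z + y).ofLp‖ ^ 2 / 16) +
        Real.exp (‖dotProduct a v₃.ofLp‖ ^ 2 / 16) +
        Real.exp (‖dotProduct a z.ofLp‖ ^ 2 / 16)) / 4 := by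
    refine le_trans (Real.exp_le_exp.2 ?_) (exp_sum_four_div_le _ _ _ _)
    have h1 := Real.sqrt_le_sqrt (bound a)
    have h2 := sqrt_mul_mul_mul_le (a := ‖dotProduct a v₁.ofLp‖)
      (b := ‖dotProduct a (z + y).ofLp‖) (norm_nonneg (dotProduct a v₃.ofLp))
      (norm_nonneg (dotProduct a z.ofLp))
    linarith
  have i₁₂ := k₁.1.fun_add k₂.1
  have i₁₂₃ := i₁₂.fun_add k₃.1
  have i := (i₁₂₃.fun_add k₄.1).div_const 4
  have hi : Integrable (fun a => Real.exp (Real.sqrt |s * rowGrad x z w a| / 16))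
      (gaussianRow n) := by
    refine i.mono' ?_ (ae_of_all _ fun a => ?_)
    · exact (((continuous_abs.measurable.comp
        ((measurable_rowGrad x z w).const_mul s)).sqrt.div_const 16).exp).aestronglyMeasurable
    · rw [Real.norm_of_nonneg (Real.exp_pos _).le]
      exact pw a
  refine ⟨hi, (integral_mono hi i pw).trans ?_⟩
  rw [integral_div, integral_add i₁₂₃ k₄.1, integral_add i₁₂ k₃.1, integral_add k₁.1 k₂.1]
  linarith [k₁.2, k₂.2, k₃.2, k₄.2]

/-! ### Sums with exponential moments of the square root -/

lemma Real.exp_le_one_add_add_sq_mul_exp_max (y : ℝ) :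
    Real.exp y ≤ 1 + y + y ^ 2 * Real.exp (max y 0) := by
  rcases le_total 0 y with hy | hy
  · rw [max_eq_left hy]
    -- multiply `1 - y ≤ exp (-y)` by `(1 + y) exp y`
    have h1 : 1 - y ≤ Real.exp (-y) := by linarith [Real.add_one_le_exp (-y)]
    have h2 : Real.exp (-y) * Real.exp y = 1 := by rw [← Real.exp_add]; simp
    have h3 := Real.exp_pos y
    have h4 : (1 - y) * Real.exp y ≤ 1 := (mul_le_mul_of_nonneg_right h1 h3.le).trans_eq h2
    nlinarith [mul_le_mul_of_nonneg_left h4 (by linarith : (0 : ℝ) ≤ 1 + y)]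
  · rw [max_eq_right hy, Real.exp_zero]
    have h1 := Real.quadratic_le_exp_of_nonneg (neg_nonneg.2 hy)
    have h2 : Real.exp (-y) * Real.exp y = 1 := by rw [← Real.exp_add]; simp
    have h3 := Real.exp_pos y
    by_contra! h
    have h5 : 1 + y + y ^ 2 / 2 < Real.exp y := by nlinarith [sq_nonneg y]
    have h6 : (1 + -y + (-y) ^ 2 / 2) * (1 + y + y ^ 2 / 2) < 1 :=
      (mul_lt_mul_of_le_of_lt_of_nonneg_of_pos h1 h5 (by nlinarith [sq_nonneg (y + 1)])
        (Real.exp_pos _)).trans_eq h2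
    nlinarith [sq_nonneg (y ^ 2)]

lemma pow_four_le_exp {t : ℝ} (ht : 0 ≤ t) : t ^ 4 ≤ 24 * 32 ^ 4 * Real.exp (t / 32) := by
  have h := Real.pow_div_factorial_le_exp (x := t / 32) (by positivity) 4
  rw [div_pow, div_div, div_le_iff₀ (by positivity)] at h
  norm_num [Nat.factorial] at h ⊢
  linarith

lemma pow_three_le_exp {t : ℝ} (ht : 0 ≤ t) : t ^ 3 ≤ 6 * 32 ^ 3 * Real.exp (t / 32) := by
  have h := Real.pow_div_factorial_le_exp (x := t / 32) (by positivity) 3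
  rw [div_pow, div_div, div_le_iff₀ (by positivity)] at h
  norm_num [Nat.factorial] at h ⊢
  linarith

/-- The truncation of a real number at height `b`, by `0`; negative values are kept. -/
noncomputable def truncAbove (b u : ℝ) : ℝ := if u ≤ b then u else 0

lemma measurable_truncAbove (b : ℝ) : Measurable (truncAbove b) :=
  Measurable.ite measurableSet_Iic measurable_id measurable_const

lemma truncAbove_le {b : ℝ} (hb : 0 ≤ b) (u : ℝ) : truncAbove b u ≤ b := by
  unfold truncAbove; split_ifs <;> assumption

/-- The truncation height `q²` and the exponent `1 / (32 q)` are matched: below the height,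
`u / (32 q) ≤ √u / 32`. -/
lemma exp_truncAbove_le {q : ℝ} (hq : 0 < q) (u : ℝ) :
    Real.exp ((32 * q)⁻¹ * truncAbove (q ^ 2) u) ≤
      1 + (32 * q)⁻¹ * u +
        (32 * q)⁻¹ ^ 2 * (24 * 32 ^ 4) * Real.exp (Real.sqrt |u| / 16) := by
  unfold truncAbove
  set l := (32 * q)⁻¹ with hl
  have hl0 : 0 < l := by positivity
  split_ifs with hu
  · refine (Real.exp_le_one_add_add_sq_mul_exp_max _).trans ?_
    have ht := Real.sqrt_nonneg |u|
    have hmax : max (l * u) 0 ≤ Real.sqrt |u| / 32 := by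
      refine max_le ?_ (by positivity)
      rcases le_total u 0 with h0 | h0
      · exact (mul_nonpos_of_nonneg_of_nonpos hl0.le h0).trans (by positivity)
      · rw [abs_of_nonneg h0] at ht ⊢
        have h1 : Real.sqrt u ≤ q := Real.sqrt_le_left hq.le |>.2 hu
        have h2 : u = Real.sqrt u * Real.sqrt u := (Real.mul_self_sqrt h0).symm
        have h3 : u ≤ q * Real.sqrt u := by
          nlinarith [mul_le_mul_of_nonneg_right h1 ht]
        rw [hl, inv_mul_le_iff₀ (by positivity)]
        linarith
    have h4 : u ^ 2 = Real.sqrt |u| ^ 4 := by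
      rw [show (4 : ℕ) = 2 * 2 from rfl, pow_mul, Real.sq_sqrt (abs_nonneg u), sq_abs]
    have h5 := pow_four_le_exp ht
    have h6 : Real.exp (Real.sqrt |u| / 16) =
        Real.exp (Real.sqrt |u| / 32) * Real.exp (Real.sqrt |u| / 32) := by
      rw [← Real.exp_add]; congr 1; ring
    gcongr 1 + l * u + ?_
    calc (l * u) ^ 2 * Real.exp (max (l * u) 0)
        = l ^ 2 * (u ^ 2 * Real.exp (max (l * u) 0)) := by ring
      _ ≤ l ^ 2 * (24 * 32 ^ 4 * Real.exp (Real.sqrt |u| / 32) *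
          Real.exp (Real.sqrt |u| / 32)) := by
          rw [h4]
          gcongr
      _ = _ := by rw [h6]; ring
  · have : 0 < u := lt_trans (by positivity) (not_le.1 hu)
    rw [mul_zero, Real.exp_zero]
    have : 0 ≤ l ^ 2 * (24 * 32 ^ 4) * Real.exp (Real.sqrt |u| / 16) := by positivity
    have : 0 ≤ l * u := by positivity
    linarith

section Tail

variable {Ω : Type*} [MeasurableSpace Ω] {P : Measure Ω} [IsProbabilityMeasure P]

lemma mgf_truncAbove_le {X : Ω → ℝ} (hX : AEMeasurable X P) (hi : Integrable X P)
    (he : Integrable (fun ω => Real.exp (Real.sqrt |X ω| / 16)) P)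
    (hle : ∫ ω, Real.exp (Real.sqrt |X ω| / 16) ∂P ≤ 2) {q : ℝ} (hq : 0 < q) :
    Integrable (fun ω => Real.exp ((32 * q)⁻¹ * truncAbove (q ^ 2) (X ω))) P ∧
      mgf (fun ω => truncAbove (q ^ 2) (X ω)) P (32 * q)⁻¹ ≤
        Real.exp ((32 * q)⁻¹ * (∫ ω, X ω ∂P) + (32 * q)⁻¹ ^ 2 * (48 * 32 ^ 4)) := by
  have i1 : Integrable (fun ω => 1 + (32 * q)⁻¹ * X ω) P :=
    (integrable_const (1 : ℝ)).fun_add (hi.const_mul _)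
  have i2 := he.const_mul ((32 * q)⁻¹ ^ 2 * (24 * 32 ^ 4))
  have i3 : Integrable (fun ω => Real.exp ((32 * q)⁻¹ * truncAbove (q ^ 2) (X ω))) P := by
    refine (i1.fun_add i2).mono' ?_ (ae_of_all _ fun ω => ?_)
    · exact (((measurable_truncAbove _).comp_aemeasurable hX).const_mul _).exp.aestronglyMeasurable
    · rw [Real.norm_of_nonneg (Real.exp_pos _).le]
      exact exp_truncAbove_le hq _
  refine ⟨i3, ?_⟩
  calc mgf (fun ω => truncAbove (q ^ 2) (X ω)) P (32 * q)⁻¹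
      ≤ ∫ ω, (1 + (32 * q)⁻¹ * X ω) +
          (32 * q)⁻¹ ^ 2 * (24 * 32 ^ 4) * Real.exp (Real.sqrt |X ω| / 16) ∂P :=
        integral_mono i3 (i1.fun_add i2) fun ω => exp_truncAbove_le hq _
    _ ≤ 1 + (32 * q)⁻¹ * (∫ ω, X ω ∂P) + (32 * q)⁻¹ ^ 2 * (24 * 32 ^ 4) * 2 := by
        rw [integral_add i1 i2, integral_const_mul,
          integral_add (integrable_const _) (hi.const_mul _), integral_const_mul]
        simp only [integral_const, probReal_univ, one_smul]
        gcongr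
    _ ≤ _ := by
        rw [add_comm _ ((32 * q)⁻¹ ^ 2 * (48 * 32 ^ 4))]
        refine le_trans (le_of_eq ?_) (Real.add_one_le_exp _)
        ring

/-- Upper tail of a sum of i.i.d. variables with exponential moments of the square root, in the
range where the heavy tail of a single summand dominates. Truncation at `m τ` costs a factor `m`,
absorbed in the exponential because `m ≤ (m τ)^{3/2}`; the truncated sum has a Chernoff bound. -/
lemma measure_sum_ge_le {m : ℕ} {X : Fin m → Ω → ℝ} (hX : ∀ k, AEMeasurable (X k) P)
    (hind : iIndepFun X P) {μ : ℝ} (hi : ∀ k, Integrable (X k) P) (hμ : ∀ k, ∫ ω, X k ω ∂P = μ)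
    (he : ∀ k, Integrable (fun ω => Real.exp (Real.sqrt |X k ω| / 16)) P)
    (hle : ∀ k, ∫ ω, Real.exp (Real.sqrt |X k ω| / 16) ∂P ≤ 2) {τ : ℝ} (hτ : 0 < τ)
    (hm : 10 ^ 15 ≤ m * τ ^ 3) :
    P.real {ω | m * (μ + 2 * τ) ≤ ∑ k, X k ω} ≤
      (1 + 12 * 32 ^ 3) * Real.exp (-(Real.sqrt (m * τ) / 32)) := by
  have hm0 : (0 : ℝ) < m := by
    by_contra! h
    have : (m : ℝ) * τ ^ 3 ≤ 0 := mul_nonpos_of_nonpos_of_nonneg h (by positivity)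
    linarith
  set q := Real.sqrt (m * τ) with hq
  have hq0 : 0 < q := Real.sqrt_pos.2 (by positivity)
  have hq2 : q ^ 2 = m * τ := Real.sq_sqrt (by positivity)
  set l := (32 * q)⁻¹ with hl
  have hl0 : 0 < l := by positivity
  set Y : Fin m → Ω → ℝ := fun k ω => truncAbove (q ^ 2) (X k ω) with hY
  have hYm : ∀ k, AEMeasurable (Y k) P := fun k =>
    (measurable_truncAbove _).comp_aemeasurable (hX k)
  have hYind : iIndepFun Y P :=
    hind.comp (fun _ => truncAbove (q ^ 2)) fun _ => measurable_truncAbove _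
  have hsub : {ω | m * (μ + 2 * τ) ≤ ∑ k, X k ω} ⊆
      {ω | m * (μ + 2 * τ) ≤ (∑ k, Y k) ω} ∪
        ⋃ k, {ω | Real.exp (q / 16) ≤ Real.exp (Real.sqrt |X k ω| / 16)} := by
    intro ω hω
    by_cases h : ∀ k, X k ω ≤ q ^ 2
    · left
      have : ∀ k, Y k ω = X k ω := fun k => if_pos (h k)
      simpa [this] using hω
    · right
      push Not at h
      obtain ⟨k, hk⟩ := h
      refine Set.mem_iUnion.2 ⟨k, Real.exp_le_exp.2 ?_⟩
      have : q ≤ Real.sqrt |X k ω| := Real.le_sqrt_of_sq_le (hk.le.trans (le_abs_self _))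
      linarith
  have hbig (k : Fin m) : P.real {ω | Real.exp (q / 16) ≤ Real.exp (Real.sqrt |X k ω| / 16)} ≤
      2 * Real.exp (-(q / 16)) := by
    have h := mul_meas_ge_le_integral_of_nonneg
      (ae_of_all P fun ω => (Real.exp_pos (Real.sqrt |X k ω| / 16)).le) (he k) (Real.exp (q / 16))
    rw [Real.exp_neg, ← div_eq_mul_inv, le_div_iff₀ (Real.exp_pos _), mul_comm]
    exact h.trans (hle k)
  have hmq : (m : ℝ) ≤ q ^ 3 := by
    refine le_of_sq_le_sq ?_ (by positivity)
    calc (m : ℝ) ^ 2 = m ^ 2 * 1 := by ring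
      _ ≤ m ^ 2 * (m * τ ^ 3) := by gcongr; linarith
      _ = (q ^ 2) ^ 3 := by rw [hq2]; ring
      _ = (q ^ 3) ^ 2 := by ring
  have hchern : P.real {ω | m * (μ + 2 * τ) ≤ (∑ k, Y k) ω} ≤ Real.exp (-(q / 32)) := by
    have hint : Integrable (fun ω => Real.exp (l * (∑ k, Y k) ω)) P := by
      refine (integrable_const (Real.exp (l * (m * q ^ 2)))).mono' ?_ (ae_of_all _ fun ω => ?_)
      · have : AEMeasurable (∑ k, Y k) P := Finset.univ.aemeasurable_sum fun k _ => hYm k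
        exact (this.const_mul l).exp.aestronglyMeasurable
      · rw [Real.norm_of_nonneg (Real.exp_pos _).le, Real.exp_le_exp, Finset.sum_apply]
        gcongr
        calc ∑ k, Y k ω ≤ ∑ _k : Fin m, q ^ 2 :=
              Finset.sum_le_sum fun k _ => truncAbove_le (by positivity) _
          _ = m * q ^ 2 := by simp
    refine (measure_ge_le_exp_mul_mgf _ hl0.le hint).trans ?_
    rw [hYind.mgf_sum₀ hYm]
    have hprod : ∏ k, mgf (Y k) P l ≤ Real.exp (m * (l * μ + l ^ 2 * (48 * 32 ^ 4))) := by
      calc ∏ k, mgf (Y k) P l ≤ ∏ _k : Fin m, Real.exp (l * μ + l ^ 2 * (48 * 32 ^ 4)) := by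
            refine Finset.prod_le_prod (fun k _ => mgf_nonneg) fun k _ => ?_
            have := (mgf_truncAbove_le (hX k) (hi k) (he k) (hle k) hq0).2
            rwa [hμ k] at this
        _ = _ := by
            rw [Finset.prod_const, Finset.card_univ, Fintype.card_fin, ← Real.exp_nat_mul]
    refine (mul_le_mul_of_nonneg_left hprod (Real.exp_pos _).le).trans ?_
    rw [← Real.exp_add, Real.exp_le_exp]
    have e1 : -l * (m * (μ + 2 * τ)) + m * (l * μ + l ^ 2 * (48 * 32 ^ 4)) =
        -(2 * l * (m * τ)) + l ^ 2 * m * (48 * 32 ^ 4) := by ring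
    have e2 : 2 * l * (m * τ) = q / 16 := by
      rw [← hq2, hl]
      field_simp
      norm_num
    have e3 : l ^ 2 * m * (48 * 32 ^ 4) ≤ q / 32 := by
      -- `l² m = 1 / (1024 τ)`, and `q τ = √(m τ³)` is large
      have hqτ : 48 * 32 ^ 3 ≤ q * τ := by
        refine le_of_sq_le_sq ?_ (by positivity)
        rw [mul_pow q, hq2]
        calc ((48 : ℝ) * 32 ^ 3) ^ 2 ≤ 10 ^ 15 := by norm_num
          _ ≤ m * τ ^ 3 := hm
          _ = m * τ * τ ^ 2 := by ring
      have : l ^ 2 * m = (1024 * τ)⁻¹ := by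
        rw [hl, inv_pow, mul_pow, hq2]
        field_simp
        norm_num
      rw [this, inv_mul_le_iff₀ (by positivity)]
      linarith
    rw [e1, e2]
    linarith
  have hexp : Real.exp (-(q / 16)) = Real.exp (-(q / 32)) * Real.exp (-(q / 32)) := by
    rw [← Real.exp_add]; congr 1; ring
  have hinv : Real.exp (q / 32) * Real.exp (-(q / 32)) = 1 := by
    rw [← Real.exp_add]; simp
  calc P.real {ω | m * (μ + 2 * τ) ≤ ∑ k, X k ω}
      ≤ P.real {ω | m * (μ + 2 * τ) ≤ (∑ k, Y k) ω} +
          P.real (⋃ k, {ω | Real.exp (q / 16) ≤ Real.exp (Real.sqrt |X k ω| / 16)}) :=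
        (measureReal_mono hsub).trans (measureReal_union_le _ _)
    _ ≤ Real.exp (-(q / 32)) + ∑ _k : Fin m, 2 * Real.exp (-(q / 16)) := by
        gcongr
        exact (measureReal_iUnion_fintype_le _).trans (Finset.sum_le_sum fun k _ => hbig k)
    _ = Real.exp (-(q / 32)) + m * (2 * Real.exp (-(q / 16))) := by simp
    _ ≤ Real.exp (-(q / 32)) +
          6 * 32 ^ 3 * Real.exp (q / 32) * (2 * Real.exp (-(q / 16))) := by
        gcongr
        exact hmq.trans (pow_three_le_exp hq0.le)
    _ = (1 + 12 * 32 ^ 3) * Real.exp (-(q / 32)) := by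
        rw [hexp]
        linear_combination 12 * 32 ^ 3 * Real.exp (-(q / 32)) * hinv

/-! ### Deviation of the gradient -/

/-- A matrix with i.i.d. standard complex Gaussian entries has i.i.d. Gaussian rows. -/
lemma hasLaw_rows {m n : ℕ} {A : Ω → Matrix (Fin m) (Fin n) ℂ}
    (hA : ∀ i j, HasLaw (fun ω => A ω i j) stdComplexGaussian P)
    (hind : iIndepFun (fun (p : Fin m × Fin n) ω => A ω p.1 p.2) P) :
    (∀ k, HasLaw (fun ω => A ω k) (gaussianRow n) P) ∧ iIndepFun (fun k ω => A ω k) P := by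
  have h1 := hind.hasLaw_pi (μ := fun _ => stdComplexGaussian) fun p : Fin m × Fin n => hA p.1 p.2
  have h2 : HasLaw (fun ω k => A ω k) (Measure.pi fun _ : Fin m => gaussianRow n) P := by
    have hc := Measure.infinitePi_map_curry (fun (_ : Fin m) (_ : Fin n) => stdComplexGaussian)
    simp only [Measure.infinitePi_eq_pi] at hc
    exact HasLaw.fun_comp (Y := MeasurableEquiv.curry (Fin m) (Fin n) ℂ)
      ⟨(MeasurableEquiv.measurable _).aemeasurable, hc⟩ h1
  have h3 (k : Fin m) : HasLaw (fun ω => A ω k) (gaussianRow n) P :=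
    (measurePreserving_eval (fun _ : Fin m => gaussianRow n) k).fun_comp_hasLaw h2
  exact ⟨h3, (iIndepFun_iff_hasLaw_pi_pi h3).2 h2⟩

/-- Deviation of the gradient of `d_A` at `z` in the direction `w` from its mean. The bound is
proportional to the distance between `z` and a rotation `y` of `x`, since each row term is. -/
lemma measure_gradient_deviation_le {m n : ℕ} {A : Ω → Matrix (Fin m) (Fin n) ℂ}
    (hA : ∀ i j, HasLaw (fun ω => A ω i j) stdComplexGaussian P)
    (hind : iIndepFun (fun (p : Fin m × Fin n) ω => A ω p.1 p.2) P)
    {x y z : EuclideanSpace ℂ (Fin n)} (w : EuclideanSpace ℂ (Fin n))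
    (hx : ‖x‖ = 1) (hz : ‖z‖ = 1) (hy : ∃ c : ℂ, ‖c‖ = 1 ∧ y = c • x)
    {τ : ℝ} (hτ : 0 < τ) (hm : 10 ^ 15 ≤ m * τ ^ 3) :
    P.real {ω | ¬ (inner ℂ w (z - inner ℂ x z • x)).re - (∑ k, rowGrad x z w (A ω k)) / (4 * m) ≤
        τ / 2 * (‖z - y‖ * ‖w‖)} ≤
      (1 + 12 * 32 ^ 3) * Real.exp (-(Real.sqrt (m * τ) / 32)) := by
  have hm0 : (0 : ℝ) < m := by
    by_contra! h
    have : (m : ℝ) * τ ^ 3 ≤ 0 := mul_nonpos_of_nonpos_of_nonneg h (by positivity)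
    linarith
  obtain ⟨c, hc, hyc⟩ := hy
  have hpos : 0 ≤ (1 + 12 * 32 ^ 3) * Real.exp (-(Real.sqrt (m * τ) / 32)) := by positivity
  by_cases hw : w = 0
  · subst hw
    simp [rowGrad]
    positivity
  by_cases hzy : z = y
  · have h1 (a : Fin n → ℂ) : rowGrad x y w a = 0 := by
      rw [rowGrad, hyc, dotProduct_smul_ofLp, norm_mul, hc]
      simp
    have h2 : y - inner ℂ x y • x = 0 := by
      rw [hyc, inner_smul_right, inner_self_eq_norm_sq_to_K, hx]
      simp
    simp only [h1, hzy, h2]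
    simpa using hpos
  obtain ⟨hlaw, hrows⟩ := hasLaw_rows hA hind
  have hy1 : ‖y‖ = 1 := by rw [hyc, norm_smul, hc, hx, one_mul]
  have hD : 0 < ‖z - y‖ * ‖w‖ :=
    mul_pos (norm_pos_iff.2 (sub_ne_zero.2 hzy)) (norm_pos_iff.2 hw)
  set D := ‖z - y‖ * ‖w‖ with hDdef
  set s := -D⁻¹ with hs
  have hsabs : |s| = (‖z - y‖ * ‖w‖)⁻¹ := by rw [hs, abs_neg, abs_of_pos (by positivity)]
  have hmeas := measurable_rowGrad x z w
  obtain ⟨hexp1, hexp2⟩ := integral_exp_sqrt_rowGrad_le hz hy1 ⟨c, hc, hyc⟩ hzy hw hsabs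
  obtain ⟨hint1, hint2⟩ := integral_rowGrad x z w hx hz
  have hexpm : Measurable fun a => Real.exp (Real.sqrt |s * rowGrad x z w a| / 16) :=
    ((continuous_abs.measurable.comp (hmeas.const_mul s)).sqrt.div_const 16).exp
  have tr {f : (Fin n → ℂ) → ℝ} (hf : Measurable f) (hfi : Integrable f (gaussianRow n))
      (k : Fin m) : Integrable (fun ω => f (A ω k)) P := by
    have := (hlaw k).map_eq ▸ hfi
    exact this.comp_aemeasurable (hlaw k).aemeasurable
  have trI {f : (Fin n → ℂ) → ℝ} (hf : Measurable f) (k : Fin m) :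
      ∫ ω, f (A ω k) ∂P = ∫ a, f a ∂(gaussianRow n) :=
    (hlaw k).integral_comp hf.aestronglyMeasurable
  refine le_trans (measureReal_mono ?_) (measure_sum_ge_le
    (X := fun k ω => s * rowGrad x z w (A ω k))
    (μ := s * (4 * (inner ℂ w (z - inner ℂ x z • x)).re))
    (fun k => ((hmeas.const_mul s).comp_aemeasurable (hlaw k).aemeasurable))
    (hrows.comp (fun _ a => s * rowGrad x z w a) fun _ => hmeas.const_mul s)
    (fun k => tr (hmeas.const_mul s) (hint1.const_mul s) k)
    (fun k => by
      rw [trI (hmeas.const_mul s) k, integral_const_mul, hint2])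
    (fun k => tr hexpm hexp1 k)
    (fun k => by rw [trI hexpm k]; exact hexp2) hτ hm)
  intro ω hω
  simp only [Set.mem_ofPred_eq, not_le] at hω ⊢
  rw [← Finset.mul_sum, hs]
  set S := ∑ k, rowGrad x z w (A ω k)
  set R := (inner ℂ w (z - inner ℂ x z • x)).re
  have h1 : D * (2 * m * τ) < 4 * m * R - S := by
    have := mul_lt_mul_of_pos_left hω (by positivity : (0 : ℝ) < 4 * m)
    rw [mul_sub, mul_div_cancel₀ _ (by positivity : (4 * m : ℝ) ≠ 0)] at this
    linarith
  rw [mul_comm D, ← lt_div_iff₀ hD] at h1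
  rw [div_eq_mul_inv] at h1
  linarith

end Tail

/-! ### Projected gradient descent under gradient concentration -/

section Deterministic

variable {m n : ℕ}

lemma fderiv_dA (A : Matrix (Fin m) (Fin n) ℂ) (x z w : EuclideanSpace ℂ (Fin n)) :
    fderiv ℝ (dA A x) z w = 4 * ∑ k, rowGrad x z w (A k) := by
  let L (k : Fin m) : EuclideanSpace ℂ (Fin n) →L[ℝ] ℂ := LinearMap.toContinuousLinearMap
    { toFun := fun v => dotProduct (A k) v.ofLp
      map_add' := fun p q => dotProduct_add_ofLp _ p q
      map_smul' := fun c p => by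
        rw [WithLp.ofLp_smul, dotProduct_smul]
        rfl }
  have hL (k : Fin m) (v : EuclideanSpace ℂ (Fin n)) : L k v = dotProduct (A k) v.ofLp := rfl
  have h : HasFDerivAt (dA A x) (∑ k, ((2 * (‖L k z‖ ^ 2 - ‖L k x‖ ^ 2) : ℝ) •
      (2 • (innerSL ℝ (L k z)).comp (L k)))) z := by
    unfold dA
    refine HasFDerivAt.fun_sum fun k _ => ?_
    have h1 := ((L k).hasFDerivAt (x := z)).norm_sq.sub_const (‖L k x‖ ^ 2)
    convert! h1.pow 2 using 1
    simp
  rw [h.fderiv, sum_apply, Finset.mul_sum]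
  refine Finset.sum_congr rfl fun k _ => ?_
  simp only [smul_apply, ContinuousLinearMap.comp_apply, innerSL_apply_apply,
    Complex.inner, hL, rowGrad, smul_eq_mul, Complex.mul_re, RCLike.star_def, Complex.conj_re,
    Complex.conj_im, nsmul_eq_mul]
  push_cast
  ring

/-- The Wirtinger gradient represents half the real differential. -/
lemma re_inner_wirtingerGrad (f : EuclideanSpace ℂ (Fin n) → ℝ) (z w : EuclideanSpace ℂ (Fin n)) :
    (inner ℂ w (wirtingerGrad f z)).re = fderiv ℝ f z w / 2 := by
  have hw : w = ∑ j, ((w j).re • EuclideanSpace.single j (1 : ℂ) +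
      (w j).im • EuclideanSpace.single j Complex.I) := by
    ext i
    simp [Pi.single_apply, Finset.sum_add_distrib]
  conv_rhs => rw [hw]
  rw [map_sum, PiLp.inner_apply, Complex.re_sum, Finset.sum_div]
  refine Finset.sum_congr rfl fun j _ => ?_
  rw [map_add, map_smul, map_smul]
  simp only [wirtingerGrad, wirtingerDeriv, RCLike.inner_apply]
  simp
  ring

lemma phaseDist_le (x z : EuclideanSpace ℂ (Fin n)) (θ : ℝ) :
    phaseDist x z ≤ ‖Complex.exp ((θ : ℂ) * Complex.I) • x - z‖ :=
  ciInf_le ⟨0, by rintro _ ⟨θ, rfl⟩; positivity⟩ θ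

/-- For unit vectors the infimum over phases is attained at the phase of `⟨x, z⟩`, and the squared
distance is `2 - 2 |⟨x, z⟩|`. -/
lemma exists_phaseDist_eq {x z : EuclideanSpace ℂ (Fin n)} (hx : ‖x‖ = 1) (hz : ‖z‖ = 1) :
    ∃ θ : ℝ, phaseDist x z = ‖z - Complex.exp ((θ : ℂ) * Complex.I) • x‖ ∧
      ‖inner ℂ x z • x - Complex.exp ((θ : ℂ) * Complex.I) • x‖ = phaseDist x z ^ 2 / 2 := by
  set p := inner ℂ x z with hp
  have hsq (θ : ℝ) : ‖Complex.exp ((θ : ℂ) * Complex.I) • x - z‖ ^ 2 =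
      2 - 2 * (star (Complex.exp ((θ : ℂ) * Complex.I)) * p).re := by
    rw [norm_sub_sq (𝕜 := ℂ), inner_smul_left, norm_smul, Complex.norm_exp_ofReal_mul_I, hx, hz]
    simp only [RCLike.re_eq_complex_re, RCLike.star_def, ← hp]
    ring
  obtain ⟨φ, hpolar⟩ : ∃ φ : ℝ, p = ‖p‖ * Complex.exp ((φ : ℂ) * Complex.I) :=
    ⟨p.arg, (Complex.norm_mul_exp_arg_mul_I p).symm⟩
  have hle : ‖p‖ ≤ 1 := by
    have := norm_inner_le_norm (𝕜 := ℂ) x z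
    rwa [hx, hz, one_mul] at this
  have harg : ‖Complex.exp ((φ : ℂ) * Complex.I) • x - z‖ ^ 2 = 2 - 2 * ‖p‖ := by
    have hu : star (Complex.exp ((φ : ℂ) * Complex.I)) *
        Complex.exp ((φ : ℂ) * Complex.I) = 1 := by
      rw [RCLike.star_def, Complex.conj_mul', Complex.norm_exp_ofReal_mul_I]
      norm_num
    have : star (Complex.exp ((φ : ℂ) * Complex.I)) * p = ‖p‖ := by
      conv_lhs => rw [hpolar]
      linear_combination (‖p‖ : ℂ) * hu
    rw [hsq, this, Complex.ofReal_re]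
  have heq : phaseDist x z = ‖Complex.exp ((φ : ℂ) * Complex.I) • x - z‖ := by
    refine le_antisymm (phaseDist_le x z _) (le_ciInf fun θ => ?_)
    refine le_of_sq_le_sq ?_ (norm_nonneg _)
    rw [harg, hsq]
    have := Complex.re_le_norm (star (Complex.exp ((θ : ℂ) * Complex.I)) * p)
    rw [norm_mul, norm_star, Complex.norm_exp_ofReal_mul_I, one_mul] at this
    linarith
  refine ⟨φ, by rw [heq, norm_sub_rev], ?_⟩
  rw [heq, harg, ← sub_smul, norm_smul, hx, mul_one]
  conv_lhs => rw [hpolar]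
  rw [show (‖p‖ : ℂ) * Complex.exp ((φ : ℂ) * Complex.I) -
      Complex.exp ((φ : ℂ) * Complex.I) =
      ((‖p‖ - 1 : ℝ) : ℂ) * Complex.exp ((φ : ℂ) * Complex.I) by push_cast; ring,
    norm_mul, Complex.norm_exp_ofReal_mul_I, Complex.norm_real, Real.norm_eq_abs,
    abs_of_nonpos (by linarith)]
  ring

/-- A projection on `C` beats every `c ∈ C`, in the form of an inequality for inner products. -/
lemma IsProjOn.sq_norm_sub_le {C : Set (EuclideanSpace ℂ (Fin n))}
    {s z' c : EuclideanSpace ℂ (Fin n)} (h : IsProjOn C s z') (hc : c ∈ C) :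
    ‖z' - c‖ ^ 2 ≤ 2 * (inner ℂ (z' - c) (s - c)).re := by
  have h1 := h.2 c hc
  have h2 := norm_sub_sq (𝕜 := ℂ) (z' - c) (s - c)
  rw [sub_sub_sub_cancel_right, RCLike.re_eq_complex_re] at h2
  rw [norm_sub_rev c s] at h1
  linarith

/-- The gradient of `d_A` concentrates at `z`, in all directions between points of `C`: its
deviation from the mean is at most `τ / 2` times the distance from `z` to the orbit of `x`. -/
def GradientConcentrates (A : Matrix (Fin m) (Fin n) ℂ) (x : EuclideanSpace ℂ (Fin n))
    (C : Set (EuclideanSpace ℂ (Fin n))) (τ : ℝ) : Prop :=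
  ∀ z ∈ C, ∀ z' ∈ C, ∀ c ∈ C,
    (inner ℂ (z' - c) (z - inner ℂ x z • x)).re - (∑ k, rowGrad x z (z' - c) (A k)) / (4 * m) ≤
      τ / 2 * (phaseDist x z * ‖z' - c‖)

/-- One projected gradient step. The mean of the step is `z ↦ ⟨x, z⟩ x`, which squares the distance
to the orbit of `x` (up to the factor `2` that the projection costs). -/
lemma phaseDist_step_le {A : Matrix (Fin m) (Fin n) ℂ} {x : EuclideanSpace ℂ (Fin n)}
    {C : Set (EuclideanSpace ℂ (Fin n))} {τ ε : ℝ} (hA : GradientConcentrates A x C τ)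
    (hx : ‖x‖ = 1) (hC : ∀ c ∈ C, ‖c‖ = 1)
    (hcover : ∀ θ : ℝ, ∃ c ∈ C, ‖Complex.exp ((θ : ℂ) * Complex.I) • x - c‖ ≤ ε)
    {z z' : EuclideanSpace ℂ (Fin n)} (hz : z ∈ C) (hd : phaseDist x z ≤ 1 - 2 * τ)
    (hz' : IsProjOn C (z - ((1 / (8 * m) : ℝ) : ℂ) • wirtingerGrad (dA A x) z) z') :
    phaseDist x z' ≤ (1 - τ) * phaseDist x z + 3 * ε := by
  obtain ⟨θ, hθ, hmean⟩ := exists_phaseDist_eq hx (hC z hz)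
  set y := Complex.exp ((θ : ℂ) * Complex.I) • x with hy
  obtain ⟨c, hc, hyc⟩ := hcover θ
  rw [← hy] at hyc
  set d := phaseDist x z with hddef
  have hd0 : 0 ≤ d := hθ ▸ norm_nonneg _
  have hproj := hz'.sq_norm_sub_le hc
  have hgood := hA z hz z' hz'.1 c hc
  set w := z' - c with hw
  have hgrad : (inner ℂ w (((1 / (8 * m) : ℝ) : ℂ) • wirtingerGrad (dA A x) z)).re =
      (∑ k, rowGrad x z w (A k)) / (4 * m) := by
    rw [inner_smul_right, Complex.re_ofReal_mul, re_inner_wirtingerGrad, fderiv_dA]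
    ring
  have hsplit : (inner ℂ w (z - ((1 / (8 * m) : ℝ) : ℂ) • wirtingerGrad (dA A x) z - c)).re =
      ((inner ℂ w (z - inner ℂ x z • x)).re - (∑ k, rowGrad x z w (A k)) / (4 * m)) +
        (inner ℂ w (inner ℂ x z • x - y)).re + (inner ℂ w (y - c)).re := by
    rw [← hgrad]
    simp only [inner_sub_right, Complex.sub_re]
    ring
  have hcs (v : EuclideanSpace ℂ (Fin n)) : (inner ℂ w v).re ≤ ‖w‖ * ‖v‖ :=
    (Complex.re_le_norm _).trans (norm_inner_le_norm _ _)
  have h1 := hcs (inner ℂ x z • x - y)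
  have h2 : (inner ℂ w (y - c)).re ≤ ‖w‖ * ε :=
    (hcs _).trans (mul_le_mul_of_nonneg_left hyc (norm_nonneg _))
  rw [hmean] at h1
  have h3 : ‖w‖ * ‖w‖ ≤ ‖w‖ * (d ^ 2 + τ * d + 2 * ε) := by
    rw [hsplit] at hproj
    nlinarith
  have hε : 0 ≤ ε := (norm_nonneg _).trans hyc
  have h4 : ‖w‖ ≤ (1 - τ) * d + 2 * ε := by
    have hdd : d ^ 2 ≤ (1 - 2 * τ) * d := by nlinarith
    rcases (norm_nonneg w).eq_or_lt with h0 | h0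
    · rw [← h0] at h3 ⊢
      nlinarith
    · have := le_of_mul_le_mul_left h3 h0
      linarith
  calc phaseDist x z' ≤ ‖y - z'‖ := phaseDist_le x z' θ
    _ = ‖(y - c) - w‖ := by rw [hw, sub_sub_sub_cancel_right]
    _ ≤ ‖y - c‖ + ‖w‖ := norm_sub_le _ _
    _ ≤ (1 - τ) * d + 3 * ε := by linarith

lemma phaseDist_iterate_le {A : Matrix (Fin m) (Fin n) ℂ} {x : EuclideanSpace ℂ (Fin n)}
    {C : Set (EuclideanSpace ℂ (Fin n))} {τ ε : ℝ} (hA : GradientConcentrates A x C τ)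
    (hx : ‖x‖ = 1) (hC : ∀ c ∈ C, ‖c‖ = 1)
    (hcover : ∀ θ : ℝ, ∃ c ∈ C, ‖Complex.exp ((θ : ℂ) * Complex.I) • x - c‖ ≤ ε)
    (hτ : 0 < τ) (hε : 0 ≤ ε) (hετ : 3 * ε ≤ τ * (1 - 2 * τ))
    {z : ℕ → EuclideanSpace ℂ (Fin n)} (hz : IsGDCoper A x C (1 / (8 * m)) z)
    (h0 : phaseDist x (z 0) = 1 - 2 * τ) (T : ℕ) :
    phaseDist x (z T) ≤ (1 - 2 * τ) * (1 - τ) ^ T + 3 / τ * ε := by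
  have hmem (t : ℕ) : z t ∈ C := by
    cases t with
    | zero => exact hz.1
    | succ t => exact (hz.2 t).1
  have hτ2 : 0 ≤ 1 - 2 * τ := by
    by_contra! h
    nlinarith
  have step (t : ℕ) (hd : phaseDist x (z t) ≤ 1 - 2 * τ) :=
    phaseDist_step_le hA hx hC hcover (hmem t) hd (hz.2 t)
  have hball (t : ℕ) : phaseDist x (z t) ≤ 1 - 2 * τ := by
    induction t with
    | zero => exact h0.le
    | succ t ih =>
      have h1 := step t ih
      have h2 : (1 - τ) * phaseDist x (z t) ≤ (1 - τ) * (1 - 2 * τ) :=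
        mul_le_mul_of_nonneg_left ih (by linarith)
      linarith
  induction T with
  | zero =>
    rw [h0, pow_zero, mul_one]
    have : 0 ≤ 3 / τ * ε := by positivity
    linarith
  | succ T ih =>
    have h1 := step T (hball T)
    have h2 := mul_le_mul_of_nonneg_left ih (by linarith : 0 ≤ 1 - τ)
    have h3 : (1 - τ) * (3 / τ * ε) + 3 * ε = 3 / τ * ε := by
      field_simp
      ring
    rw [pow_succ]
    linarith

end Deterministic

/-! ### Rate and dimension of codes on a set containing a circle -/

namespace CodeFamily

variable {n : ℕ} (F : CodeFamily n) {Q : Set (EuclideanSpace ℂ (Fin n))}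

lemma norm_sub_le_distortion (hQ : Bornology.IsBounded Q) (r : ℕ) {q : EuclideanSpace ℂ (Fin n)}
    (hq : q ∈ Q) : ‖q - F.dec r (F.enc r q)‖ ≤ F.distortion Q r := by
  obtain ⟨R, hR⟩ := hQ.exists_norm_le
  obtain ⟨S, hS⟩ := (Set.finite_range (F.dec r)).isBounded.exists_norm_le
  have hb : BddAbove (Set.range fun q : Q =>
      ‖(q : EuclideanSpace ℂ (Fin n)) - F.dec r (F.enc r q)‖) := by
    refine ⟨R + S, ?_⟩
    rintro _ ⟨q, rfl⟩
    exact (norm_sub_le _ _).trans (add_le_add (hR _ q.2) (hS _ ⟨_, rfl⟩))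
  exact le_ciSup hb ⟨q, hq⟩

lemma rate_antitone : Antitone (F.rate Q) := fun _ _ h =>
  le_iInf₂ fun s hs =>
    iInf₂_le (f := fun s (_ : F.distortion Q s < _) => (s : ℕ∞)) s (hs.trans_le h)

/-- Among `2^r + 1` points of the circle through `x` two are encoded alike, so the distortion is at
least half their distance. The points have their real parts spaced by `2^{-r}`. -/
lemma inv_two_pow_le_two_mul_distortion (hQ : Bornology.IsBounded Q)
    {x : EuclideanSpace ℂ (Fin n)} (hx : ‖x‖ = 1)
    (hxQ : ∀ θ : ℝ, Complex.exp ((θ : ℂ) * Complex.I) • x ∈ Q) (r : ℕ) :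
    (2 ^ r : ℝ)⁻¹ ≤ 2 * F.distortion Q r := by
  set t : Fin (2 ^ r + 1) → ℝ := fun k => (k : ℝ) / 2 ^ r with ht
  set p : Fin (2 ^ r + 1) → EuclideanSpace ℂ (Fin n) := fun k =>
    Complex.exp ((Real.arccos (t k) : ℂ) * Complex.I) • x with hp
  have hcos (k : Fin (2 ^ r + 1)) : Real.cos (Real.arccos (t k)) = t k := by
    have h0 : 0 ≤ t k := by positivity
    refine Real.cos_arccos (by linarith) ?_
    rw [ht]
    refine div_le_one_of_le₀ ?_ (by positivity)
    exact_mod_cast Nat.lt_succ_iff.1 k.2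
  obtain ⟨j, k, hjk, he⟩ := Fintype.exists_ne_map_eq_of_card_lt (fun k => F.enc r (p k))
    (by simp)
  have hj := F.norm_sub_le_distortion hQ r (hxQ (Real.arccos (t j)))
  have hk := F.norm_sub_le_distortion hQ r (hxQ (Real.arccos (t k)))
  change ‖p j - F.dec r (F.enc r (p j))‖ ≤ _ at hj
  change ‖p k - F.dec r (F.enc r (p k))‖ ≤ _ at hk
  rw [he] at hj
  have h1 : ‖p j - p k‖ ≤ 2 * F.distortion Q r := by
    have := norm_sub_le (p j - F.dec r (F.enc r (p k))) (p k - F.dec r (F.enc r (p k)))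
    rw [sub_sub_sub_cancel_right] at this
    linarith
  have h2 : |t j - t k| ≤ ‖p j - p k‖ := by
    rw [hp]
    dsimp only
    rw [← sub_smul, norm_smul, hx, mul_one]
    have := Complex.abs_re_le_norm (Complex.exp ((Real.arccos (t j) : ℂ) * Complex.I) -
      Complex.exp ((Real.arccos (t k) : ℂ) * Complex.I))
    rwa [Complex.sub_re, Complex.exp_ofReal_mul_I_re, Complex.exp_ofReal_mul_I_re, hcos, hcos]
      at this
  refine le_trans ?_ (h2.trans h1)
  have h3 : (1 : ℝ) ≤ |(j : ℝ) - k| := by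
    have : (j : ℤ) - k ≠ 0 := fun h => hjk (Fin.ext (by omega))
    exact_mod_cast Int.one_le_abs this
  rw [ht]
  dsimp only
  rw [← sub_div, abs_div, abs_of_pos (by positivity : (0 : ℝ) < 2 ^ r), inv_eq_one_div]
  gcongr

/-- The circle through `x` has dimension one, which bounds the `α`-dimension away from zero. -/
lemma alphaDim_ne_zero (hQ : Bornology.IsBounded Q)
    {x : EuclideanSpace ℂ (Fin n)} (hx : ‖x‖ = 1)
    (hxQ : ∀ θ : ℝ, Complex.exp ((θ : ℂ) * Complex.I) • x ∈ Q) : F.alphaDim Q ≠ 0 := by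
  have key : ∀ᶠ δ : ℝ in 𝓝[>] 0,
      (2 : ℝ≥0∞)⁻¹ ≤ (F.rate Q δ : ℝ≥0∞) / ENNReal.ofReal (Real.logb 2 (1 / δ)) := by
    filter_upwards [Ioo_mem_nhdsGT (show (0 : ℝ) < 1 / 4 by norm_num)] with δ hδ
    have hδ0 : 0 < δ := hδ.1
    set L := Real.logb 2 (1 / δ) with hL
    have hL2 : 2 ≤ L := by
      rw [hL, Real.le_logb_iff_rpow_le (by norm_num) (by positivity), le_div_iff₀ hδ0]
      norm_num
      linarith [hδ.2]
    have hN : ((⌈L / 2⌉₊ : ℕ) : ℕ∞) ≤ F.rate Q δ := by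
      refine le_iInf₂ fun s hs => ?_
      rw [Nat.cast_le, Nat.ceil_le]
      have h1 := F.inv_two_pow_le_two_mul_distortion hQ hx hxQ s
      have h2 : (2 ^ s : ℝ)⁻¹ < 2 * δ := by linarith
      have h3 : 1 / δ < 2 ^ (s + 1) := by
        rw [div_lt_iff₀ hδ0, pow_succ]
        rw [inv_lt_iff_one_lt_mul₀ (by positivity)] at h2
        linarith
      have h4 : L < s + 1 := by
        rw [hL, Real.logb_lt_iff_lt_rpow (by norm_num) (by positivity)]
        exact_mod_cast h3
      linarith
    have hLpos : ENNReal.ofReal L ≠ 0 := by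
      rw [Ne, ENNReal.ofReal_eq_zero]
      linarith
    rw [ENNReal.le_div_iff_mul_le (Or.inl hLpos) (Or.inl ENNReal.ofReal_ne_top)]
    calc (2 : ℝ≥0∞)⁻¹ * ENNReal.ofReal L = ENNReal.ofReal (L / 2) := by
          rw [ENNReal.ofReal_div_of_pos (by norm_num), div_eq_mul_inv, mul_comm]
          norm_num
      _ ≤ ENNReal.ofReal (⌈L / 2⌉₊ : ℕ) := ENNReal.ofReal_le_ofReal (Nat.le_ceil _)
      _ = (((⌈L / 2⌉₊ : ℕ) : ℕ∞) : ℝ≥0∞) := by rw [ENNReal.ofReal_natCast]; rfl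
      _ ≤ (F.rate Q δ : ℝ≥0∞) := by exact_mod_cast hN
  have h := le_limsup_of_frequently_le' key.frequently
  intro h0
  change (2 : ℝ≥0∞)⁻¹ ≤ F.alphaDim Q at h
  rw [h0] at h
  simp at h

/-- For large rates the definition of the `α`-dimension bounds `r` by
`2 dim log₂ (1 / δ)`: a rate at most `r(δ)` forces `δ` to be small. -/
lemma exists_le_two_mul_alphaDim (h0 : F.alphaDim Q ≠ 0) (htop : F.alphaDim Q ≠ ⊤) :
    ∃ r₀ : ℕ, ∀ r : ℕ, r₀ ≤ r → ∀ δ : ℝ, 0 < δ → (r : ℕ∞) ≤ F.rate Q δ →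
      (r : ℝ≥0∞) ≤ 2 * (F.alphaDim Q * ENNReal.ofReal (Real.logb 2 (1 / δ))) := by
  have hlt : F.alphaDim Q < 2 * F.alphaDim Q := by
    rw [two_mul]
    exact ENNReal.lt_add_right htop h0
  have hev := eventually_lt_of_limsup_lt hlt
  obtain ⟨ε, hε0, hε⟩ := mem_nhdsGT_iff_exists_Ioo_subset.1 hev
  have hε0' : 0 < ε := hε0
  have hbound (δ : ℝ) (hδ0 : 0 < δ) (hδε : δ < ε) (hδ1 : δ < 1) :
      (F.rate Q δ : ℝ≥0∞) ≤ 2 * (F.alphaDim Q * ENNReal.ofReal (Real.logb 2 (1 / δ))) := by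
    have h1 : (F.rate Q δ : ℝ≥0∞) / ENNReal.ofReal (Real.logb 2 (1 / δ)) < 2 * F.alphaDim Q :=
      hε ⟨hδ0, hδε⟩
    have hL : ENNReal.ofReal (Real.logb 2 (1 / δ)) ≠ 0 := by
      rw [Ne, ENNReal.ofReal_eq_zero, not_le]
      exact Real.logb_pos (by norm_num) (by rw [lt_div_iff₀ hδ0]; linarith)
    rw [← mul_assoc]
    exact (ENNReal.div_le_iff hL ENNReal.ofReal_ne_top).1 h1.le
  set δ₁ := min ε 1 / 2 with hδ₁
  have hmin : 0 < min ε 1 := lt_min hε0' one_pos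
  have hδ₁0 : 0 < δ₁ := by positivity
  have hδ₁ε : δ₁ < ε := (half_lt_self hmin).trans_le (min_le_left _ _)
  have hδ₁1 : δ₁ < 1 := (half_lt_self hmin).trans_le (min_le_right _ _)
  have hfin : F.rate Q δ₁ ≠ ⊤ := by
    intro h
    have := hbound δ₁ hδ₁0 hδ₁ε hδ₁1
    rw [h, ENat.toENNReal_top, top_le_iff] at this
    exact ENNReal.mul_ne_top (by norm_num) (ENNReal.mul_ne_top htop ENNReal.ofReal_ne_top) this
  obtain ⟨N, hN⟩ := ENat.ne_top_iff_exists.1 hfin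
  refine ⟨N + 1, fun r hr δ hδ0 hrδ => ?_⟩
  have hδ : δ < δ₁ := by
    by_contra! h
    have := hrδ.trans (F.rate_antitone h)
    rw [← hN, Nat.cast_le] at this
    omega
  calc (r : ℝ≥0∞) = ((r : ℕ∞) : ℝ≥0∞) := by simp
    _ ≤ (F.rate Q δ : ℝ≥0∞) := by exact_mod_cast hrδ
    _ ≤ _ := hbound δ hδ0 (hδ.trans hδ₁ε) (hδ.trans hδ₁1)

end CodeFamily

/-! ### The union bound and the choice of constants -/

/-- Union bound over the triples of codewords, indexed by triples of words in `{0,1}^r`. -/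
lemma measure_not_gradientConcentrates_le {Ω : Type*} [MeasurableSpace Ω] {P : Measure Ω}
    [IsProbabilityMeasure P] {m n : ℕ} {A : Ω → Matrix (Fin m) (Fin n) ℂ}
    (hA : ∀ i j, HasLaw (fun ω => A ω i j) stdComplexGaussian P)
    (hind : iIndepFun (fun (p : Fin m × Fin n) ω => A ω p.1 p.2) P)
    (F : CodeFamily n) (Q : Set (EuclideanSpace ℂ (Fin n))) (r : ℕ)
    (hC : ∀ c ∈ F.codebook Q r, ‖c‖ = 1) {x : EuclideanSpace ℂ (Fin n)} (hx : ‖x‖ = 1)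
    {τ : ℝ} (hτ : 0 < τ) (hm : 10 ^ 15 ≤ m * τ ^ 3) :
    P.real {ω | ¬ GradientConcentrates (A ω) x (F.codebook Q r) τ} ≤
      8 ^ r * ((1 + 12 * 32 ^ 3) * Real.exp (-(Real.sqrt (m * τ) / 32))) := by
  set B := (1 + 12 * 32 ^ 3) * Real.exp (-(Real.sqrt (m * τ) / 32)) with hB
  have hB0 : 0 ≤ B := by positivity
  set bad : (Fin r → Bool) × (Fin r → Bool) × (Fin r → Bool) → Set Ω := fun b =>
    {ω | F.dec r b.1 ∈ F.codebook Q r ∧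
      ¬ (inner ℂ (F.dec r b.2.1 - F.dec r b.2.2)
          (F.dec r b.1 - inner ℂ x (F.dec r b.1) • x)).re -
        (∑ k, rowGrad x (F.dec r b.1) (F.dec r b.2.1 - F.dec r b.2.2) (A ω k)) / (4 * m) ≤
      τ / 2 * (phaseDist x (F.dec r b.1) * ‖F.dec r b.2.1 - F.dec r b.2.2‖)} with hbad
  have hsub : {ω | ¬ GradientConcentrates (A ω) x (F.codebook Q r) τ} ⊆ ⋃ b, bad b := by
    intro ω hω
    simp only [GradientConcentrates, Set.mem_ofPred_eq, not_forall] at hω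
    obtain ⟨z, hz, z', hz', c, hc, h⟩ := hω
    obtain ⟨q₁, -, rfl⟩ := id hz
    obtain ⟨q₂, -, rfl⟩ := id hz'
    obtain ⟨q₃, -, rfl⟩ := id hc
    exact Set.mem_iUnion.2 ⟨(F.enc r q₁, F.enc r q₂, F.enc r q₃), hz, h⟩
  have hone (b : (Fin r → Bool) × (Fin r → Bool) × (Fin r → Bool)) : P.real (bad b) ≤ B := by
    by_cases hb : F.dec r b.1 ∈ F.codebook Q r
    · have hz := hC _ hb
      obtain ⟨θ, hθ, -⟩ := exists_phaseDist_eq hx hz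
      have h := measure_gradient_deviation_le hA hind (F.dec r b.2.1 - F.dec r b.2.2) hx hz
        ⟨Complex.exp ((θ : ℂ) * Complex.I), Complex.norm_exp_ofReal_mul_I θ, rfl⟩ hτ hm
      rw [← hθ] at h
      exact (measureReal_mono fun ω hω => hω.2).trans h
    · have : bad b = ∅ := Set.eq_empty_of_forall_notMem fun ω hω => hb hω.1
      rw [this, measureReal_empty]
      exact hB0
  calc _ ≤ P.real (⋃ b, bad b) := measureReal_mono hsub
    _ ≤ ∑ b, P.real (bad b) := measureReal_iUnion_fintype_le _
    _ ≤ ∑ _b : (Fin r → Bool) × (Fin r → Bool) × (Fin r → Bool), B :=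
        Finset.sum_le_sum fun b _ => hone b
    _ = 8 ^ r * B := by
        simp only [Finset.sum_const, Finset.card_univ, Fintype.card_prod, Fintype.card_fun,
          Fintype.card_bool, Fintype.card_fin, nsmul_eq_mul]
        push_cast
        rw [← mul_pow, ← mul_pow]
        norm_num

/-- The union bound over triples of codewords is absorbed by the tail bound. -/
lemma eight_pow_mul_exp_le {r : ℕ} {q : ℝ} (h : 192 * (r : ℝ) ≤ q) :
    (8 : ℝ) ^ r * Real.exp (-(q / 32)) ≤ Real.exp (-(q / 64)) := by
  have h8 : (8 : ℝ) ≤ Real.exp 3 := by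
    have h2 : (2 : ℝ) ≤ Real.exp 1 := by linarith [Real.add_one_le_exp (1 : ℝ)]
    calc (8 : ℝ) = 2 ^ 3 := by norm_num
      _ ≤ Real.exp 1 ^ 3 := by gcongr
      _ = Real.exp 3 := by rw [← Real.exp_nat_mul]; norm_num
  calc (8 : ℝ) ^ r * Real.exp (-(q / 32)) ≤ Real.exp 3 ^ r * Real.exp (-(q / 32)) := by gcongr
    _ = Real.exp (r * 3 + -(q / 32)) := by rw [← Real.exp_nat_mul, ← Real.exp_add]
    _ ≤ Real.exp (-(q / 64)) := Real.exp_le_exp.2 (by linarith)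

/-- The lower bound on the number of measurements, solved for the rate; `D` stands for
`dim log₂ (1 / δ)`. -/
lemma rate_le_of_measurements {r m : ℕ} {D : ℝ≥0∞} {τ : ℝ} (hτ : 0 < τ)
    (hr : (r : ℝ≥0∞) ≤ 2 * D) (hm : ENNReal.ofReal (4 * 192 ^ 2 / τ) * D ^ 2 ≤ m) :
    192 * (r : ℝ) ≤ Real.sqrt (m * τ) := by
  have h1 : ENNReal.ofReal (4 * 192 ^ 2 / τ * (r : ℝ) ^ 2) ≤ ENNReal.ofReal (4 * m) := by
    rw [ENNReal.ofReal_mul (by positivity), ENNReal.ofReal_pow (by positivity),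
      ENNReal.ofReal_natCast, ENNReal.ofReal_mul (by norm_num), ENNReal.ofReal_natCast]
    calc ENNReal.ofReal (4 * 192 ^ 2 / τ) * (r : ℝ≥0∞) ^ 2
        ≤ ENNReal.ofReal (4 * 192 ^ 2 / τ) * (2 * D) ^ 2 := by gcongr
      _ = 4 * (ENNReal.ofReal (4 * 192 ^ 2 / τ) * D ^ 2) := by ring
      _ ≤ ENNReal.ofReal 4 * m := by
          rw [ENNReal.ofReal_ofNat]
          gcongr
  rw [ENNReal.ofReal_le_ofReal_iff (by positivity), div_mul_eq_mul_div, div_le_iff₀ hτ] at h1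
  refine Real.le_sqrt_of_sq_le ?_
  linarith

theorem corollary2 :
    ∃ C₁ C₂ C₃ C₄ : ℝ, 0 < C₁ ∧ 0 < C₂ ∧ 0 < C₃ ∧ 0 < C₄ ∧
      ∀ (n : ℕ) (Q : Set (EuclideanSpace ℂ (Fin n))) (F : CodeFamily n),
        Bornology.IsBounded Q →
        ∃ r₀ : ℕ, ∀ r : ℕ, r₀ ≤ r →
          -- the codewords are normalized
          (∀ c ∈ F.codebook Q r, ‖c‖ = 1) →
          ∀ (x : EuclideanSpace ℂ (Fin n)), ‖x‖ = 1 →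
          (∀ θ : ℝ, Complex.exp ((θ : ℂ) * Complex.I) • x ∈ Q) →
          -- the rate-`r` code has distortion at most `δ`, and no code of smaller rate beats `δ`
          ∀ (δ : ℝ), F.distortion Q r ≤ δ → (r : ℕ∞) ≤ F.rate Q δ →
          ∀ (τ : ℝ), 0 < τ → δ ≤ τ * (1 - 2 * τ) / 3 →
          ∀ (m : ℕ), (C₂ / τ) ^ 3 ≤ (m : ℝ) →
          ENNReal.ofReal (C₄ / τ) *
              (F.alphaDim Q * ENNReal.ofReal (Real.logb 2 (1 / δ))) ^ 2 ≤ (m : ℝ≥0∞) →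
          ∀ {Ω : Type*} [MeasurableSpace Ω] (P : Measure Ω) [IsProbabilityMeasure P]
            (A : Ω → Matrix (Fin m) (Fin n) ℂ),
          (∀ i j, HasLaw (fun ω => A ω i j) stdComplexGaussian P) →
          iIndepFun (fun (p : Fin m × Fin n) ω => A ω p.1 p.2) P →
          1 - C₃ * Real.exp (-(C₁ * Real.sqrt τ / 2 * Real.sqrt m)) ≤
            P.real {ω | ∀ z : ℕ → EuclideanSpace ℂ (Fin n),
              IsGDCoper (A ω) x (F.codebook Q r) (1 / (8 * m)) z →
              phaseDist x (z 0) = 1 - 2 * τ →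
              ∀ T : ℕ, phaseDist x (z T) ≤
                (1 - 2 * τ) * (1 - τ) ^ T + 3 / τ * F.distortion Q r} := by
  -- `C₂³ = 10¹⁵` is the threshold on `m τ³` in the tail bound; `C₄` gives `192 r ≤ √(m τ)`, so that
  -- half of the exponent `√(m τ) / 32` survives the union bound and `C₁ / 2 = 1 / 64`
  refine ⟨1 / 32, 10 ^ 5, 1 + 12 * 32 ^ 3, 4 * 192 ^ 2, by norm_num, by norm_num, by norm_num,
    by norm_num, fun n Q F hQ => ?_⟩
  obtain ⟨r₀, hr₀⟩ : ∃ r₀ : ℕ, F.alphaDim Q ≠ 0 → F.alphaDim Q ≠ ⊤ → ∀ r : ℕ, r₀ ≤ r →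
      ∀ δ : ℝ, 0 < δ → (r : ℕ∞) ≤ F.rate Q δ →
      (r : ℝ≥0∞) ≤ 2 * (F.alphaDim Q * ENNReal.ofReal (Real.logb 2 (1 / δ))) := by
    by_cases h : F.alphaDim Q ≠ 0 ∧ F.alphaDim Q ≠ ⊤
    · obtain ⟨r₀, h₀⟩ := F.exists_le_two_mul_alphaDim h.1 h.2
      exact ⟨r₀, fun _ _ => h₀⟩
    · exact ⟨0, fun h1 h2 => absurd ⟨h1, h2⟩ h⟩
  refine ⟨r₀, fun r hr hC x hx hxQ δ hrδ hrate τ hτ hδτ m hm hmD Ω _ P _ A hA hind => ?_⟩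
  have hdist := F.inv_two_pow_le_two_mul_distortion hQ hx hxQ r
  have hdist0 : 0 < F.distortion Q r := by
    have : (0 : ℝ) < (2 ^ r : ℝ)⁻¹ := by positivity
    linarith
  have hδ0 : 0 < δ := hdist0.trans_le hrδ
  have hdim0 : F.alphaDim Q ≠ 0 := F.alphaDim_ne_zero hQ hx hxQ
  have hδ1 : δ < 1 := by nlinarith [sq_nonneg (4 * τ - 1)]
  have hlog : ENNReal.ofReal (Real.logb 2 (1 / δ)) ≠ 0 := by
    rw [Ne, ENNReal.ofReal_eq_zero, not_le]
    exact Real.logb_pos (by norm_num) (by rw [lt_div_iff₀ hδ0]; linarith)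
  -- an infinite dimension would require infinitely many measurements
  have hdimtop : F.alphaDim Q ≠ ⊤ := by
    intro h
    rw [h, ENNReal.top_mul hlog, ENNReal.top_pow (by norm_num), ENNReal.mul_top] at hmD
    · exact ENNReal.natCast_ne_top m (top_le_iff.1 hmD)
    · rw [Ne, ENNReal.ofReal_eq_zero, not_le]
      positivity
  have hrq := rate_le_of_measurements hτ (hr₀ hdim0 hdimtop r hr δ hδ0 hrate) hmD
  have hm' : 10 ^ 15 ≤ m * τ ^ 3 := by
    rw [div_pow, div_le_iff₀ (by positivity)] at hm
    norm_num at hm ⊢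
    linarith
  have hexp : 1 / 32 * Real.sqrt τ / 2 * Real.sqrt m = Real.sqrt (m * τ) / 64 := by
    rw [Real.sqrt_mul (Nat.cast_nonneg m)]
    ring
  have hbad := measure_not_gradientConcentrates_le hA hind F Q r hC hx hτ hm'
  have htail := eight_pow_mul_exp_le hrq
  have hfail : P.real {ω | ¬ GradientConcentrates (A ω) x (F.codebook Q r) τ} ≤
      (1 + 12 * 32 ^ 3) * Real.exp (-(Real.sqrt (m * τ) / 64)) := by
    refine hbad.trans ?_
    rw [mul_left_comm]
    gcongr
  -- the event need not be measurable, so its complement is only bounded by subadditivity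
  have hcover : 1 ≤ P.real {ω | GradientConcentrates (A ω) x (F.codebook Q r) τ} +
      P.real {ω | ¬ GradientConcentrates (A ω) x (F.codebook Q r) τ} := by
    rw [← probReal_univ (μ := P)]
    refine le_trans (measureReal_mono fun ω _ => ?_) (measureReal_union_le _ _)
    exact em _
  rw [hexp]
  refine le_trans (by linarith) (measureReal_mono
    (μ := P) (s₁ := {ω | GradientConcentrates (A ω) x (F.codebook Q r) τ}) fun ω hω z hz h0 T => ?_)
  refine phaseDist_iterate_le hω hx hC (fun θ => ?_) hτ hdist0.le (by linarith) hz h0 T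
  exact ⟨_, ⟨_, hxQ θ, rfl⟩, F.norm_sub_le_distortion hQ r (hxQ θ)⟩
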